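/- Let $N\ge 2$ and write points of $\mathbb{R}^N$ as $x=(x',x_N)\in\mathbb{R}^{N-1}\times\mathbb{R}$. There is a constant $c=c(N)>0$ such that the following holds for all real $b^-<b^+$. Let $\Omega=\{x\in\mathbb{R}^N : b^-<x_N<b^+\}$ and let $\nu$ be its outward unit normal on $\partial\Omega$. Let $\dot W^{1,1}(\Omega)$ be the space of real functions $u\in L^1_{\mathrm{loc}}(\Omega)$ all of whose first order weak partial derivatives belong to $L^1(\Omega)$ (functions equal almost everywhere in $\Omega$ are identified). Let $L^1_{\mathrm{loc}}(\partial\Omega)$ be taken with respect to the $(N-1)$-dimensional Hausdorff measure $\mathcal{H}^{N-1}$, normalised to be Lebesgue measure on $\mathbb{R}^{N-1}$. Then there exists a unique linear operator $$\operatorname{Tr}:\dot W^{1,1}(\Omega)\to L^1_{\mathrm{loc}}(\partial\Omega)$$ with the following three properties (it is also the only linear operator with these properties when $c$ in (2) is replaced by any other constant). (1) $\operatorname{Tr}(u)=u$ on $\partial\Omega$ for all $u\in\dot W^{1,1}(\Omega)\cap C^0(\overline\Omega)$. (2) For every $u\in\dot W^{1,1}(\Omega)$ and every $0<\varepsilon<b^+-b^-$,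 $$\int_{\mathbb{R}^{N-1}}|\operatorname{Tr}(u)(x',b^+)-\operatorname{Tr}(u)(x',b^-)|\,dx'\le\int_\Omega|\partial_N u(x)|\,dx,$$ and, on each of the two faces $x_N=b^+$ and $x_N=b^-$, $$\sup_{|h'|\le\varepsilon}\int_{\mathbb{R}^{N-1}}|\operatorname{Tr}(u)(x'+h',b^\pm)-\operatorname{Tr}(u)(x',b^\pm)|\,dx'\le c\int_{\Omega_\varepsilon}|\nabla u(x)|\,dx,$$ where $\Omega_\varepsilon=\mathbb{R}^{N-1}\times\big((b^-,b^-+\varepsilon)\cup(b^+-\varepsilon,b^+)\big)$. In particular, $$\lim_{\varepsilon\to0^+}\ \sup_{|h'|\le\varepsilon}\int_{\mathbb{R}^{N-1}}|\operatorname{Tr}(u)(x'+h',b^\pm)-\operatorname{Tr}(u)(x',b^\pm)|\,dx'=0.$$ (3) For all $u\in\dot W^{1,1}(\Omega)$, all $\psi\in C^1_c(\mathbb{R}^N)$ and all $i=1,\dots,N$, the function $u\,\partial_i\psi$ is integrable on $\Omega$ and $$\int_\Omega u\,\partial_i\psi\,dx=-\int_\Omega\psi\,\partial_i u\,dx+\int_{\partial\Omega}\psi\operatorname{Tr}(u)\,\nu_i\,d\mathcal{H}^{N-1}.$$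 -/

import Mathlib

open MeasureTheory Set Filter Topology
open scoped ENNReal ContDiff

noncomputable section

/-- The `i`-th classical partial derivative of `φ : ℝ^d → ℝ`. -/
def partialDeriv {d : ℕ} (i : Fin d) (φ : EuclideanSpace ℝ (Fin d) → ℝ)
    (x : EuclideanSpace ℝ (Fin d)) : ℝ :=
  fderiv ℝ φ x (EuclideanSpace.single i 1)

/-- `g` is an `i`-th weak (distributional) partial derivative of `u` in `Ω`, tested against
`φ ∈ C_c^∞(Ω)`. It is used below only for `u` and `g` locally integrable in `Ω`. -/
def HasWeakPartial {d : ℕ} (Ω : Set (EuclideanSpace ℝ (Fin d))) (i : Fin d)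
    (u g : EuclideanSpace ℝ (Fin d) → ℝ) : Prop :=
  ∀ φ : EuclideanSpace ℝ (Fin d) → ℝ, ContDiff ℝ ∞ φ → HasCompactSupport φ → tsupport φ ⊆ Ω →
    ∫ x in Ω, u x * partialDeriv i φ x = - ∫ x in Ω, g x * φ x

theorem integrableOn_mul_of_compact {d : ℕ} {Ω : Set (EuclideanSpace ℝ (Fin d))}
    {u φ : EuclideanSpace ℝ (Fin d) → ℝ} (hu : LocallyIntegrableOn u Ω)
    (hφ : Continuous φ) (hc : HasCompactSupport φ) (hs : tsupport φ ⊆ Ω) :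
    IntegrableOn (fun x => u x * φ x) Ω := by
  have h1 : IntegrableOn u (tsupport φ) := hu.integrableOn_compact_subset hs hc
  have h2 : IntegrableOn (fun x => u x * φ x) (tsupport φ) :=
    h1.mul_continuousOn hφ.continuousOn hc
  refine (IntegrableOn.integrable_of_forall_notMem_eq_zero h2 fun x hx => ?_).integrableOn
  simp [image_eq_zero_of_notMem_tsupport hx]

theorem continuous_partialDeriv {d : ℕ} (i : Fin d) {φ : EuclideanSpace ℝ (Fin d) → ℝ}
    (hφ : ContDiff ℝ ∞ φ) : Continuous (partialDeriv i φ) :=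
  (hφ.continuous_fderiv (by simp)).clm_apply continuous_const

theorem tsupport_partialDeriv_subset {d : ℕ} (i : Fin d) (φ : EuclideanSpace ℝ (Fin d) → ℝ) :
    tsupport (partialDeriv i φ) ⊆ tsupport φ :=
  tsupport_fderiv_apply_subset ℝ _

theorem integrableOn_mul_partialDeriv {d : ℕ} {Ω : Set (EuclideanSpace ℝ (Fin d))}
    {u φ : EuclideanSpace ℝ (Fin d) → ℝ} (i : Fin d) (hu : LocallyIntegrableOn u Ω)
    (hφ : ContDiff ℝ ∞ φ) (hc : HasCompactSupport φ) (hs : tsupport φ ⊆ Ω) :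
    IntegrableOn (fun x => u x * partialDeriv i φ x) Ω :=
  integrableOn_mul_of_compact hu (continuous_partialDeriv i hφ)
    (hc.mono' ((subset_tsupport _).trans (tsupport_partialDeriv_subset i φ)))
    ((tsupport_partialDeriv_subset i φ).trans hs)

/-- The homogeneous Sobolev space `Ẇ^{1,1}(Ω)`: real functions `u ∈ L¹_loc(Ω)`, up to equality
almost everywhere in `Ω`, whose first order weak partial derivatives all belong to `L¹(Ω)`. -/
def HomSobolev {d : ℕ} (Ω : Set (EuclideanSpace ℝ (Fin d))) :
    Submodule ℝ (EuclideanSpace ℝ (Fin d) →ₘ[volume.restrict Ω] ℝ) where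
  carrier := {u | LocallyIntegrableOn u Ω ∧
    ∀ i : Fin d, ∃ g : EuclideanSpace ℝ (Fin d) → ℝ, IntegrableOn g Ω ∧ HasWeakPartial Ω i u g}
  add_mem' := by
    rintro u v ⟨hu, hu'⟩ ⟨hv, hv'⟩
    refine ⟨(hu.add hv).congr (AEEqFun.coeFn_add u v).symm, fun i => ?_⟩
    obtain ⟨g, hg, hgu⟩ := hu' i
    obtain ⟨k, hk, hkv⟩ := hv' i
    refine ⟨g + k, hg.add hk, fun φ h1 h2 h3 => ?_⟩
    have e : ∫ x in Ω, (u + v : _ →ₘ[volume.restrict Ω] ℝ) x * partialDeriv i φ x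
        = ∫ x in Ω, (u x * partialDeriv i φ x + v x * partialDeriv i φ x) := by
      refine integral_congr_ae ?_
      filter_upwards [AEEqFun.coeFn_add u v] with x hx
      rw [hx, Pi.add_apply, add_mul]
    have e2 : ∫ x in Ω, (g + k) x * φ x = ∫ x in Ω, (g x * φ x + k x * φ x) := by
      simp only [Pi.add_apply, add_mul]
    rw [e, e2, integral_add (integrableOn_mul_partialDeriv i hu h1 h2 h3)
      (integrableOn_mul_partialDeriv i hv h1 h2 h3),
      integral_add (integrableOn_mul_of_compact hg.locallyIntegrableOn h1.continuous h2 h3)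
      (integrableOn_mul_of_compact hk.locallyIntegrableOn h1.continuous h2 h3),
      hgu φ h1 h2 h3, hkv φ h1 h2 h3, neg_add]
  zero_mem' := by
    have h0 : (0 : EuclideanSpace ℝ (Fin d) → ℝ) =ᵐ[volume.restrict Ω]
      (0 : EuclideanSpace ℝ (Fin d) →ₘ[volume.restrict Ω] ℝ) := AEEqFun.coeFn_zero.symm
    refine ⟨LocallyIntegrableOn.congr h0 locallyIntegrableOn_zero, fun i =>
      ⟨0, integrableOn_zero, fun φ h1 h2 h3 => ?_⟩⟩
    have e : ∫ x in Ω, (0 : EuclideanSpace ℝ (Fin d) →ₘ[volume.restrict Ω] ℝ) x *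
        partialDeriv i φ x = ∫ x in Ω, (0 : ℝ) := by
      refine integral_congr_ae ?_
      filter_upwards [h0] with x hx
      rw [← hx, Pi.zero_apply, zero_mul]
    rw [e]
    simp
  smul_mem' := by
    rintro c u ⟨hu, hu'⟩
    refine ⟨(hu.smul c).congr (AEEqFun.coeFn_smul c u).symm, fun i => ?_⟩
    obtain ⟨g, hg, hgu⟩ := hu' i
    refine ⟨c • g, hg.smul c, fun φ h1 h2 h3 => ?_⟩
    have e : ∫ x in Ω, (c • u : _ →ₘ[volume.restrict Ω] ℝ) x * partialDeriv i φ x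
        = ∫ x in Ω, c * (u x * partialDeriv i φ x) := by
      refine integral_congr_ae ?_
      filter_upwards [AEEqFun.coeFn_smul c u] with x hx
      rw [hx, Pi.smul_apply, smul_eq_mul, mul_assoc]
    have e2 : ∫ x in Ω, (c • g) x * φ x = ∫ x in Ω, c * (g x * φ x) := by
      simp only [Pi.smul_apply, smul_eq_mul, mul_assoc]
    rw [e, e2, integral_const_mul, integral_const_mul, hgu φ h1 h2 h3, mul_neg]

/-- The weak partial derivative `∂ᵢ u ∈ L¹(Ω)` of `u ∈ Ẇ^{1,1}(Ω)` (for `Ω` open it is unique up to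
equality almost everywhere in `Ω`). -/
def weakPartial {d : ℕ} {Ω : Set (EuclideanSpace ℝ (Fin d))} (u : HomSobolev Ω) (i : Fin d) :
    EuclideanSpace ℝ (Fin d) → ℝ :=
  (u.2.2 i).choose

theorem integrableOn_weakPartial {d : ℕ} {Ω : Set (EuclideanSpace ℝ (Fin d))} (u : HomSobolev Ω)
    (i : Fin d) : IntegrableOn (weakPartial u i) Ω :=
  (u.2.2 i).choose_spec.1

theorem hasWeakPartial_weakPartial {d : ℕ} {Ω : Set (EuclideanSpace ℝ (Fin d))}
    (u : HomSobolev Ω) (i : Fin d) :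
    HasWeakPartial Ω i (u : EuclideanSpace ℝ (Fin d) →ₘ[volume.restrict Ω] ℝ) (weakPartial u i) :=
  (u.2.2 i).choose_spec.2

/-- The weak gradient `∇u` of `u ∈ Ẇ^{1,1}(Ω)`; its pointwise norm is the Euclidean one. -/
def weakGradient {d : ℕ} {Ω : Set (EuclideanSpace ℝ (Fin d))} (u : HomSobolev Ω)
    (x : EuclideanSpace ℝ (Fin d)) : EuclideanSpace ℝ (Fin d) :=
  WithLp.toLp 2 fun i => weakPartial u i x

/-- The point `(x', t) ∈ ℝ^n × ℝ = ℝ^{n+1}`, whose last coordinate is `t`. -/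
def withLast {n : ℕ} (x' : EuclideanSpace ℝ (Fin n)) (t : ℝ) : EuclideanSpace ℝ (Fin (n + 1)) :=
  WithLp.toLp 2 (Fin.snoc (α := fun _ => ℝ) x' t)

/-- The flat strip `ℝ^n × (b⁻, b⁺)` in `ℝ^{n+1}`. -/
def strip (n : ℕ) (bm bp : ℝ) : Set (EuclideanSpace ℝ (Fin (n + 1))) :=
  {x | bm < x (Fin.last n) ∧ x (Fin.last n) < bp}

/-- The set `ℝ^n × ((b⁻, b⁻ + ε) ∪ (b⁺ - ε, b⁺))`. -/
def stripCollar (n : ℕ) (bm bp ε : ℝ) : Set (EuclideanSpace ℝ (Fin (n + 1))) :=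
  {x | x (Fin.last n) ∈ Ioo bm (bm + ε) ∪ Ioo (bp - ε) bp}

/-- The `n`-dimensional Hausdorff measure (normalised to be Lebesgue measure on `ℝ^n`) on the
topological boundary of `Ω ⊆ ℝ^{n+1}`. -/
def surfaceMeasure {n : ℕ} (Ω : Set (EuclideanSpace ℝ (Fin (n + 1)))) :
    Measure (EuclideanSpace ℝ (Fin (n + 1))) :=
  (Measure.euclideanHausdorffMeasure n).restrict (frontier Ω)

/-- The space `L¹_loc(∂Ω)`: classes, up to almost everywhere equality for the surface measure, of
functions that are locally integrable for the surface measure. -/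
def LocL1Boundary {n : ℕ} (Ω : Set (EuclideanSpace ℝ (Fin (n + 1)))) :
    Submodule ℝ (EuclideanSpace ℝ (Fin (n + 1)) →ₘ[surfaceMeasure Ω] ℝ) where
  carrier := {f | LocallyIntegrable f (surfaceMeasure Ω)}
  add_mem' := fun {f g} hf hg =>
    LocallyIntegrable.congr (LocallyIntegrable.add hf hg) (AEEqFun.coeFn_add f g).symm
  zero_mem' := LocallyIntegrable.congr locallyIntegrable_zero AEEqFun.coeFn_zero.symm
  smul_mem' := fun c f hf =>
    LocallyIntegrable.congr (LocallyIntegrable.smul hf c) (AEEqFun.coeFn_smul c f).symm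

/-- A representative `ℝ^{n+1} → ℝ` (meaningful almost everywhere on `∂Ω`) of `f ∈ L¹_loc(∂Ω)`. -/
def boundaryRep {n : ℕ} {Ω : Set (EuclideanSpace ℝ (Fin (n + 1)))} (f : LocL1Boundary Ω) :
    EuclideanSpace ℝ (Fin (n + 1)) → ℝ :=
  (f : EuclideanSpace ℝ (Fin (n + 1)) →ₘ[surfaceMeasure Ω] ℝ)

/-- A representative (meaningful almost everywhere in `Ω`) of `u ∈ Ẇ^{1,1}(Ω)`. -/
def sobolevRep {d : ℕ} {Ω : Set (EuclideanSpace ℝ (Fin d))} (u : HomSobolev Ω) :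
    EuclideanSpace ℝ (Fin d) → ℝ :=
  (u : EuclideanSpace ℝ (Fin d) →ₘ[volume.restrict Ω] ℝ)

/-- The `i`-th component of the outward unit normal of the strip, at a point of its boundary:
the normal is `e_{n+1}` on the top face `x_{n+1} = b⁺` and `-e_{n+1}` on the bottom face. -/
def stripNormal {n : ℕ} (bp : ℝ) (i : Fin (n + 1)) (x : EuclideanSpace ℝ (Fin (n + 1))) : ℝ :=
  if i = Fin.last n then (if x (Fin.last n) = bp then 1 else -1) else 0

/-- The `L¹(ℝ^n)` modulus of continuity
`sup_{|h'| ≤ ε} ∫ |f(x' + h', b) - f(x', b)| dx'` of `f` on the hyperplane `x_{n+1} = b`. -/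
def faceModulus {n : ℕ} (f : EuclideanSpace ℝ (Fin (n + 1)) → ℝ) (b ε : ℝ) : ℝ≥0∞ :=
  ⨆ h : EuclideanSpace ℝ (Fin n), ⨆ _ : ‖h‖ ≤ ε,
    ∫⁻ x' : EuclideanSpace ℝ (Fin n), ‖f (withLast (x' + h) b) - f (withLast x' b)‖ₑ

/-- The defining properties of the trace on the strip, with constant `c`. -/
structure IsStripTrace (n : ℕ) (bm bp c : ℝ)
    (Tr : HomSobolev (strip n bm bp) →ₗ[ℝ] LocL1Boundary (strip n bm bp)) : Prop where
  /-- `Tr u = u` on `∂Ω` if `u` has a representative `v` that is continuous up to the boundary. -/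
  eq_of_continuous : ∀ (u : HomSobolev (strip n bm bp)) (v : EuclideanSpace ℝ (Fin (n + 1)) → ℝ),
    ContinuousOn v (closure (strip n bm bp)) → sobolevRep u =ᵐ[volume.restrict (strip n bm bp)] v →
    boundaryRep (Tr u) =ᵐ[surfaceMeasure (strip n bm bp)] v
  /-- The `L¹` estimate of the jump between the two faces. -/
  jump_le : ∀ u : HomSobolev (strip n bm bp),
    ∫⁻ x' : EuclideanSpace ℝ (Fin n),
        ‖boundaryRep (Tr u) (withLast x' bp) - boundaryRep (Tr u) (withLast x' bm)‖ₑ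
      ≤ ∫⁻ x in strip n bm bp, ‖weakPartial u (Fin.last n) x‖ₑ
  /-- The estimate of the modulus of continuity on each of the two faces. -/
  modulus_le : ∀ (u : HomSobolev (strip n bm bp)) (ε : ℝ), 0 < ε → ε < bp - bm →
    ∀ b ∈ ({bm, bp} : Set ℝ), faceModulus (boundaryRep (Tr u)) b ε
      ≤ ENNReal.ofReal c * ∫⁻ x in stripCollar n bm bp ε, ‖weakGradient u x‖ₑ
  /-- The modulus of continuity on each of the two faces tends to `0`. -/
  modulus_tendsto : ∀ u : HomSobolev (strip n bm bp), ∀ b ∈ ({bm, bp} : Set ℝ),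
    Tendsto (fun ε => faceModulus (boundaryRep (Tr u)) b ε) (𝓝[>] 0) (𝓝 0)
  /-- The integral over `Ω` on the left of the integration by parts formula converges. -/
  integrableOn_mul : ∀ (u : HomSobolev (strip n bm bp)) (ψ : EuclideanSpace ℝ (Fin (n + 1)) → ℝ),
    ContDiff ℝ 1 ψ → HasCompactSupport ψ → ∀ i : Fin (n + 1),
    IntegrableOn (fun x => sobolevRep u x * partialDeriv i ψ x) (strip n bm bp)
  /-- Integration by parts. -/
  integral_by_parts : ∀ (u : HomSobolev (strip n bm bp)) (ψ : EuclideanSpace ℝ (Fin (n + 1)) → ℝ),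
    ContDiff ℝ 1 ψ → HasCompactSupport ψ → ∀ i : Fin (n + 1),
    ∫ x in strip n bm bp, sobolevRep u x * partialDeriv i ψ x
      = - (∫ x in strip n bm bp, ψ x * weakPartial u i x)
        + ∫ x, ψ x * boundaryRep (Tr u) x * stripNormal bp i x ∂(surfaceMeasure (strip n bm bp))

end

/-
On almost every vertical segment `u` is absolutely continuous: it has a representative
`f(x') + ∫_{b⁻}^t ∂_{n+1} u(x', s) ds` with `f` locally integrable, and the values of this
representative at `t = b^±` are the trace. The bound of the jump is then immediate. For the modulus
of continuity on a face, let `J ⊆ (b⁻, b⁺)` be the interval of length `ε` next to it, and compare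
the horizontal increment by `h'` at the face with the one at a height `t ∈ J`: their `L¹(ℝ^n)` norms
differ by at most twice the integral of `|∂_{n+1} u|` over `ℝ^n × J`, and the average over `t ∈ J`
of the second norm is at most `|h'| / ε ≤ 1` times the integral of `|∇u|` over `ℝ^n × J`. This gives
the constant `3`. Finally the integration by parts formula determines the pairing of the trace with
every test function, hence the trace itself; linearity follows in the same way.
-/

noncomputable section

open Function
open scoped Pointwise

section CompactSupport

variable {X : Type*} [TopologicalSpace X] [MeasurableSpace X] {μ : Measure X} {Ω : Set X}
  {u φ : X → ℝ}

theorem integrable_mul_of_tsupport_subset [OpensMeasurableSpace X] [T2Space X]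
    (hu : LocallyIntegrableOn u Ω μ) (hφ : Continuous φ)
    (hc : HasCompactSupport φ) (hs : tsupport φ ⊆ Ω) : Integrable (fun x => u x * φ x) μ := by
  have hK : IntegrableOn (fun x => u x * φ x) (tsupport φ) μ :=
    (hu.integrableOn_compact_subset hs hc).mul_continuousOn hφ.continuousOn hc
  exact hK.integrable_of_forall_notMem_eq_zero fun x hx => by
    simp [image_eq_zero_of_notMem_tsupport hx]

theorem setIntegral_mul_of_tsupport_subset (hs : tsupport φ ⊆ Ω) :
    ∫ x in Ω, u x * φ x ∂μ = ∫ x, u x * φ x ∂μ :=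
  setIntegral_eq_integral_of_forall_compl_eq_zero fun x hx => by
    simp [image_eq_zero_of_notMem_tsupport fun hx' => hx (hs hx')]

end CompactSupport

section Segment

variable {E : Type*} [NormedAddCommGroup E] [NormedSpace ℝ E] {Ω : Set E} {φ : E → ℝ}

theorem tsupport_intervalIntegral_comp_sub_smul_subset (hc : HasCompactSupport φ) (h : E) (τ : ℝ) :
    tsupport (fun x => ∫ s in 0..τ, φ (x - s • h)) ⊆ tsupport φ + (· • h) '' uIcc 0 τ := by
  have hK : IsCompact (tsupport φ + (· • h) '' uIcc 0 τ) :=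
    hc.isCompact.add (isCompact_uIcc.image (by fun_prop))
  refine closure_minimal (fun x hx => ?_) hK.isClosed
  contrapose! hx
  refine notMem_support.2 ((intervalIntegral.integral_congr fun s hs => ?_).trans
    intervalIntegral.integral_zero)
  exact image_eq_zero_of_notMem_tsupport fun hxs =>
    hx ⟨_, hxs, _, mem_image_of_mem _ hs, sub_add_cancel _ _⟩

theorem isOpen_setOf_segment_subset (hΩ : IsOpen Ω) (h : E) (τ : ℝ) :
    IsOpen {x | ∀ s ∈ uIcc 0 τ, x + s • h ∈ Ω} := by
  refine isOpen_iff_eventually.2 fun x hx =>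
    isCompact_uIcc.eventually_forall_of_forall_eventually fun s hs => ?_
  exact (by fun_prop : Continuous fun p : E × ℝ => p.1 + p.2 • h).continuousAt.eventually
    (hΩ.mem_nhds (hx s hs))

theorem intervalIntegral_fderiv_comp_sub_smul (hφ : ContDiff ℝ 1 φ) (x h : E) (τ : ℝ) :
    ∫ s in 0..τ, fderiv ℝ φ (x - s • h) h = φ x - φ (x - τ • h) := by
  have hderiv : ∀ s ∈ uIcc 0 τ,
      HasDerivAt (fun s : ℝ => -φ (x - s • h)) (fderiv ℝ φ (x - s • h) h) s := fun s _ => by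
    have hs : HasDerivAt (fun s : ℝ => x - s • h) (-h) s := by
      simpa using ((hasDerivAt_id s).smul_const h).const_sub x
    have hφs := (hφ.differentiable one_ne_zero (x - s • h)).hasFDerivAt.comp_hasDerivAt s hs
    rw [map_neg] at hφs
    simpa only [neg_neg, comp_apply] using hφs.fun_neg
  have hcont : Continuous fun s : ℝ => fderiv ℝ φ (x - s • h) h :=
    ((hφ.continuous_fderiv one_ne_zero).comp (by fun_prop)).clm_apply continuous_const
  rw [intervalIntegral.integral_eq_sub_of_hasDerivAt hderiv (hcont.intervalIntegrable _ _)]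
  simp [add_comm, ← sub_eq_add_neg]

end Segment

section Translation

theorem locallyIntegrableOn_comp_homeomorph {X Y : Type*} [TopologicalSpace X] [MeasurableSpace X]
    [BorelSpace X] [TopologicalSpace Y] [MeasurableSpace Y] [BorelSpace Y] {μ : Measure X}
    {ν : Measure Y} {Ω : Set Y} {u : Y → ℝ} (e : X ≃ₜ Y) (he : MeasurePreserving e μ ν)
    (hu : LocallyIntegrableOn u Ω ν) : LocallyIntegrableOn (u ∘ e) (e ⁻¹' Ω) μ := fun x hx => by
  obtain ⟨U, hU, huU⟩ := hu (e x) hx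
  exact ⟨e ⁻¹' U, e.continuous.continuousWithinAt.preimage_mem_nhdsWithin'' hU rfl,
    (he.integrableOn_comp_preimage e.measurableEmbedding).2 huU⟩

variable {E : Type*} [NormedAddCommGroup E] [MeasurableSpace E] [BorelSpace E]
  {μ : Measure E} {Ω U : Set E} {u φ : E → ℝ} {h : E}

theorem integral_comp_add_sub_mul
    (hμ : MeasurePreserving (· + h) μ μ) (hu : LocallyIntegrableOn u Ω μ)
    (hUΩ : U ⊆ Ω) (hUh : ∀ x ∈ U, x + h ∈ Ω) (hφ : Continuous φ) (hc : HasCompactSupport φ)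
    (hs : tsupport φ ⊆ U) :
    ∫ x, (u (x + h) - u x) * φ x ∂μ = ∫ x in Ω, u x * (φ (x - h) - φ x) ∂μ := by
  have hemb : MeasurableEmbedding (· + h) := (Homeomorph.addRight h).measurableEmbedding
  have hi : Integrable (fun x => u x * φ x) μ :=
    integrable_mul_of_tsupport_subset hu hφ hc (hs.trans hUΩ)
  have hih : Integrable (fun x => u (x + h) * φ x) μ :=
    integrable_mul_of_tsupport_subset
      ((locallyIntegrableOn_comp_homeomorph (.addRight h) hμ hu).mono_set hUh) hφ hc hs
  have hih' : Integrable (fun x => u x * φ (x - h)) μ :=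
    (hμ.integrable_comp_emb hemb).1 (by simpa [Function.comp_def] using hih)
  have hzero : ∀ x ∉ Ω, u x * (φ (x - h) - φ x) = 0 := fun x hx => by
    have hφx : φ x = 0 := image_eq_zero_of_notMem_tsupport fun hx' => hx (hUΩ (hs hx'))
    have hφxh : φ (x - h) = 0 :=
      image_eq_zero_of_notMem_tsupport fun hx' => hx (by simpa using hUh _ (hs hx'))
    rw [hφx, hφxh, sub_zero, mul_zero]
  rw [setIntegral_eq_integral_of_forall_compl_eq_zero hzero]
  simp only [sub_mul, mul_sub]
  rw [integral_sub hih hi, integral_sub hih' hi]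
  congr 1
  simpa using hμ.integral_comp hemb fun x => u x * φ (x - h)

end Translation

section LineDerivative

variable {E : Type*} [NormedAddCommGroup E] [NormedSpace ℝ E] [MeasurableSpace E] [BorelSpace E]
  {μ : Measure E} {Ω : Set E} {u g φ : E → ℝ} {h : E}

instance isFiniteMeasure_restrict_uIoc (a b : ℝ) :
    IsFiniteMeasure ((volume : Measure ℝ).restrict (uIoc a b)) :=
  inferInstanceAs (IsFiniteMeasure (volume.restrict (Ioc _ _)))

theorem integrable_uncurry_comp_add_smul [SecondCountableTopology E] [SFinite μ]
    (hμ : ∀ s : ℝ, MeasurePreserving (· + s • h) μ μ) (hg : Integrable g μ)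
    (ν : Measure ℝ) [IsFiniteMeasure ν] :
    Integrable (fun p : ℝ × E => g (p.2 + p.1 • h)) (ν.prod μ) := by
  have hmp : MeasurePreserving (fun p : ℝ × E => (p.1, p.2 + p.1 • h)) (ν.prod μ) (ν.prod μ) :=
    (MeasurePreserving.id ν).skew_product (g := fun s x => x + s • h) (by fun_prop)
      (.of_forall fun s => (hμ s).map_eq)
  exact hmp.integrable_comp_of_integrable (hg.comp_snd ν)

theorem integrable_intervalIntegral_comp_add_smul [SecondCountableTopology E] [SFinite μ]
    (hμ : ∀ s : ℝ, MeasurePreserving (· + s • h) μ μ) (hg : Integrable g μ) (τ : ℝ) :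
    Integrable (fun x => ∫ s in 0..τ, g (x + s • h)) μ := by
  simp_rw [intervalIntegral.intervalIntegral_eq_integral_uIoc]
  have hunc := integrable_uncurry_comp_add_smul hμ hg (volume.restrict (uIoc 0 τ))
  exact hunc.integral_prod_right.smul (if 0 ≤ τ then 1 else -1 : ℝ)

theorem integral_intervalIntegral_comp_add_smul_mul [SecondCountableTopology E] [SFinite μ]
    (hμ : ∀ s : ℝ, MeasurePreserving (· + s • h) μ μ) (hg : Integrable g μ) (hφ : Continuous φ)
    (hc : HasCompactSupport φ) (τ : ℝ) :
    ∫ x, (∫ s in 0..τ, g (x + s • h)) * φ x ∂μ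
      = ∫ s in 0..τ, ∫ x, g x * φ (x - s • h) ∂μ := by
  obtain ⟨C, hC⟩ := hc.exists_bound_of_continuous hφ
  have hint : Integrable (fun p : ℝ × E => g (p.2 + p.1 • h) * φ p.2)
      ((volume.restrict (uIoc 0 τ)).prod μ) :=
    (integrable_uncurry_comp_add_smul hμ hg _).mul_bdd (c := C) (by fun_prop)
      (.of_forall fun p => hC p.2)
  simp_rw [← intervalIntegral.integral_mul_const]
  rw [← intervalIntegral_integral_swap hint]
  refine intervalIntegral.integral_congr fun s _ => ?_
  have hemb : MeasurableEmbedding (· + s • h) := (Homeomorph.addRight (s • h)).measurableEmbedding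
  simpa using (hμ s).integral_comp hemb fun x => g x * φ (x - s • h)

theorem integral_mul_intervalIntegral_comp_sub_smul [SecondCountableTopology E] [SFinite μ]
    (hg : LocallyIntegrable g μ) (hφ : Continuous φ) (hc : HasCompactSupport φ) (τ : ℝ) :
    ∫ x, g x * (∫ s in 0..τ, φ (x - s • h)) ∂μ
      = ∫ s in 0..τ, ∫ x, g x * φ (x - s • h) ∂μ := by
  obtain ⟨C, hC⟩ := hc.exists_bound_of_continuous hφ
  have hK : IsCompact (tsupport φ + (· • h) '' uIcc 0 τ) :=
    hc.isCompact.add (isCompact_uIcc.image (by fun_prop))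
  have hgK := ((integrable_indicator_iff hK.measurableSet).2
    (hg.integrableOn_isCompact hK)).comp_snd (volume.restrict (uIoc 0 τ))
  have hint : Integrable (fun p : ℝ × E => g p.2 * φ (p.2 - p.1 • h))
      ((volume.restrict (uIoc 0 τ)).prod μ) := by
    refine (hgK.mul_bdd (g := fun p : ℝ × E => φ (p.2 - p.1 • h)) (c := C) (by fun_prop)
      (.of_forall fun p => hC _)).congr ?_
    filter_upwards [Measure.quasiMeasurePreserving_fst.ae
      (ae_restrict_mem (μ := volume) (measurableSet_uIoc (a := 0) (b := τ)))] with p hp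
    by_cases hpK : p.2 ∈ tsupport φ + (· • h) '' uIcc 0 τ
    · rw [indicator_of_mem hpK]
    · rw [image_eq_zero_of_notMem_tsupport fun hp' => hpK ⟨_, hp', _,
        mem_image_of_mem _ (uIoc_subset_uIcc hp), sub_add_cancel _ _⟩, mul_zero, mul_zero]
  simp_rw [← intervalIntegral.integral_const_mul]
  exact (intervalIntegral_integral_swap hint).symm

theorem contDiff_intervalIntegral_comp_sub_smul {n : ℕ∞} (hφ : ContDiff ℝ n φ)
    (hc : HasCompactSupport φ) (h : E) (τ : ℝ) :
    ContDiff ℝ n fun x => ∫ s in 0..τ, φ (x - s • h) := by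
  have hh : Measurable fun s : ℝ => s • h := by fun_prop
  -- The average is a convolution with the image of Lebesgue measure on the segment `[0, τ • h]`.
  set ν : Measure E := (volume.restrict (uIoc 0 τ)).map fun s : ℝ => s • h
  have hone : LocallyIntegrable (fun _ : E => (1 : ℝ)) ν := (integrable_const 1).locallyIntegrable
  convert (hc.contDiff_convolution_right (ContinuousLinearMap.lsmul ℝ ℝ) hone hφ).const_smul
    (if 0 ≤ τ then 1 else -1 : ℝ) using 2 with x
  have hm : AEStronglyMeasurable (fun y => φ (x - y)) ν :=
    (hφ.continuous.comp (by fun_prop)).aestronglyMeasurable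
  rw [intervalIntegral.intervalIntegral_eq_integral_uIoc, convolution_lsmul]
  simp only [one_smul]
  rw [integral_map hh.aemeasurable hm]

theorem fderiv_intervalIntegral_comp_sub_smul (hφ : ContDiff ℝ 1 φ) (hc : HasCompactSupport φ)
    (x h : E) (τ : ℝ) :
    fderiv ℝ (fun x => ∫ s in 0..τ, φ (x - s • h)) x h = φ x - φ (x - τ • h) := by
  have hline : HasDerivAt (fun r : ℝ => x + r • h) h 0 := by
    simpa using ((hasDerivAt_id (0 : ℝ)).smul_const h).const_add x
  have hfderiv : HasDerivAt (fun r : ℝ => ∫ s in 0..τ, φ (x + r • h - s • h))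
      (fderiv ℝ (fun x => ∫ s in 0..τ, φ (x - s • h)) x h) 0 := by
    have hd := (contDiff_intervalIntegral_comp_sub_smul (n := 1) hφ hc h τ).differentiable
      one_ne_zero x
    exact HasFDerivAt.comp_hasDerivAt (0 : ℝ) (by simpa using hd.hasFDerivAt) hline
  have hcont : Continuous fun r : ℝ => φ (x + r • h) := hφ.continuous.comp (by fun_prop)
  have hshift : (fun r : ℝ => ∫ s in 0..τ, φ (x + r • h - s • h))
      = fun r => (∫ s in 0..r, φ (x + s • h)) - ∫ s in 0..r - τ, φ (x + s • h) := by
    funext r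
    rw [intervalIntegral.integral_interval_sub_left (hcont.intervalIntegrable _ _)
      (hcont.intervalIntegrable _ _)]
    simpa [sub_smul, add_sub_assoc] using
      intervalIntegral.integral_comp_sub_left (fun s => φ (x + s • h)) r (a := 0) (b := τ)
  rw [hshift] at hfderiv
  have hprim : ∀ r : ℝ, HasDerivAt (fun r : ℝ => ∫ s in 0..r, φ (x + s • h)) (φ (x + r • h)) r :=
    fun r => hcont.integral_hasStrictDerivAt 0 r |>.hasDerivAt
  have hsub := (hprim 0).sub ((hprim (0 - τ)).comp_sub_const 0 τ)
  simpa [sub_eq_add_neg] using hfderiv.unique hsub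

/-- `g` is a weak derivative of `u` in the direction `h` in the set `Ω`, for the measure `μ`: the
directional version of `HasWeakPartial`, on an arbitrary normed space. -/
def HasWeakLineDeriv (μ : Measure E) (Ω : Set E) (u g : E → ℝ) (h : E) : Prop :=
  ∀ φ : E → ℝ, ContDiff ℝ ∞ φ → HasCompactSupport φ → tsupport φ ⊆ Ω →
    ∫ x in Ω, u x * fderiv ℝ φ x h ∂μ = -∫ x in Ω, g x * φ x ∂μ

variable [FiniteDimensional ℝ E] [μ.IsAddHaarMeasure]

namespace HasWeakLineDeriv

theorem integral_mul_sub (hw : HasWeakLineDeriv μ Ω u g h) (hg : IntegrableOn g Ω μ)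
    (hΩ : MeasurableSet Ω)
    (hφ : ContDiff ℝ ∞ φ) (hc : HasCompactSupport φ) {τ : ℝ}
    (hs : tsupport φ ⊆ {x | ∀ s ∈ uIcc 0 τ, x + s • h ∈ Ω}) :
    ∫ x in Ω, u x * (φ (x - τ • h) - φ x) ∂μ
      = ∫ x, (∫ s in 0..τ, Ω.indicator g (x + s • h)) * φ x ∂μ := by
  have hg' : Integrable (Ω.indicator g) μ := (integrable_indicator_iff hΩ).2 hg
  set Φ : E → ℝ := fun x => ∫ s in 0..τ, φ (x - s • h) with hΦ
  have hsub : tsupport Φ ⊆ tsupport φ + (· • h) '' uIcc 0 τ :=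
    tsupport_intervalIntegral_comp_sub_smul_subset hc h τ
  have hΦs : tsupport Φ ⊆ Ω := by
    refine hsub.trans ?_
    rintro _ ⟨x, hx, _, ⟨s, hsτ, rfl⟩, rfl⟩
    exact hs hx s hsτ
  have hΦc : HasCompactSupport Φ :=
    (hc.isCompact.add (isCompact_uIcc.image (by fun_prop))).of_isClosed_subset
      (isClosed_tsupport _) hsub
  calc ∫ x in Ω, u x * (φ (x - τ • h) - φ x) ∂μ
      = -∫ x in Ω, u x * fderiv ℝ Φ x h ∂μ := by
        simp_rw [hΦ, fderiv_intervalIntegral_comp_sub_smul (hφ.of_le (mod_cast le_top)) hc,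
          ← integral_neg, ← mul_neg, neg_sub]
    _ = ∫ x in Ω, g x * Φ x ∂μ := by
        rw [hw Φ (contDiff_intervalIntegral_comp_sub_smul (n := ⊤) hφ hc h τ) hΦc hΦs, neg_neg]
    _ = ∫ x, Ω.indicator g x * Φ x ∂μ := by
        rw [← integral_indicator hΩ]
        simp only [indicator_mul_left]
    _ = ∫ x, (∫ s in 0..τ, Ω.indicator g (x + s • h)) * φ x ∂μ := by
        rw [integral_mul_intervalIntegral_comp_sub_smul hg'.locallyIntegrable hφ.continuous hc,
          integral_intervalIntegral_comp_add_smul_mul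
            (fun s => measurePreserving_add_right μ (s • h)) hg' hφ.continuous hc]

theorem ae_sub_eq_intervalIntegral (hw : HasWeakLineDeriv μ Ω u g h) (hΩ : IsOpen Ω)
    (hu : LocallyIntegrableOn u Ω μ) (hg : IntegrableOn g Ω μ) (τ : ℝ) :
    ∀ᵐ x ∂μ, (∀ s ∈ uIcc 0 τ, x + s • h ∈ Ω) →
      u (x + τ • h) - u x = ∫ s in 0..τ, g (x + s • h) := by
  set U := {x | ∀ s ∈ uIcc 0 τ, x + s • h ∈ Ω}
  have hU : IsOpen U := isOpen_setOf_segment_subset hΩ h τ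
  have hUΩ : U ⊆ Ω := fun x hx => by simpa using hx 0 left_mem_uIcc
  have hUτ : ∀ x ∈ U, x + τ • h ∈ Ω := fun x hx => hx τ right_mem_uIcc
  have hincr : LocallyIntegrableOn (fun x => u (x + τ • h) - u x) U μ :=
    ((locallyIntegrableOn_comp_homeomorph (.addRight (τ • h)) (measurePreserving_add_right μ _)
      hu).mono_set hUτ).sub
      (hu.mono_set hUΩ)
  have hprim : Integrable (fun x => ∫ s in 0..τ, Ω.indicator g (x + s • h)) μ :=
    integrable_intervalIntegral_comp_add_smul (fun s => measurePreserving_add_right μ (s • h))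
      ((integrable_indicator_iff hΩ.measurableSet).2 hg) τ
  have hprim' := hprim.locallyIntegrable.locallyIntegrableOn U
  have hzero := hU.ae_eq_zero_of_integral_contDiff_smul_eq_zero (hincr.sub hprim')
    fun φ hφ hc hs => by
      simp only [smul_eq_mul, mul_comm (φ _), Pi.sub_apply, sub_mul (_ - _)]
      rw [integral_sub (integrable_mul_of_tsupport_subset hincr hφ.continuous hc hs)
        (integrable_mul_of_tsupport_subset hprim' hφ.continuous hc hs),
        integral_comp_add_sub_mul (measurePreserving_add_right μ _) hu hUΩ hUτ
          hφ.continuous hc hs,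
        hw.integral_mul_sub hg hΩ.measurableSet hφ hc hs, sub_self]
  filter_upwards [hzero] with x hx hxU
  refine (sub_eq_zero.1 (hx hxU)).trans ?_
  exact intervalIntegral.integral_congr fun s hs => indicator_of_mem (hxU s hs) g

end HasWeakLineDeriv

end LineDerivative

section InvariantMeasure

variable {E : Type*} [NormedAddCommGroup E] [NormedSpace ℝ E] [MeasurableSpace E] [BorelSpace E]
  {μ : Measure E} {u g φ : E → ℝ} {h : E}

theorem continuous_integral_mul_comp_sub_smul (hu : LocallyIntegrable u μ) (hφ : Continuous φ)
    (hc : HasCompactSupport φ) (h : E) :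
    Continuous fun s : ℝ => ∫ x, u x * φ (x - s • h) ∂μ := by
  have hconv := (hc.comp_homeomorph (Homeomorph.neg E)).continuous_convolution_right
    (ContinuousLinearMap.lsmul ℝ ℝ) hu (hφ.comp continuous_neg)
  convert hconv.comp (by fun_prop : Continuous fun s : ℝ => s • h) using 2 with s
  simp [convolution_lsmul]

variable [SecondCountableTopology E] [SFinite μ]

theorem integral_mul_fderiv_eq_neg (hμ : ∀ s : ℝ, MeasurePreserving (· + s • h) μ μ)
    (hu : LocallyIntegrable u μ) (hg : Integrable g μ)
    (hincr : ∀ τ : ℝ, ∀ᵐ x ∂μ, u (x + τ • h) - u x = ∫ s in 0..τ, g (x + s • h))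
    (hφ : ContDiff ℝ 1 φ) (hc : HasCompactSupport φ) :
    ∫ x, u x * fderiv ℝ φ x h ∂μ = -∫ x, g x * φ x ∂μ := by
  have hφ' : Continuous fun x => fderiv ℝ φ x h :=
    (hφ.continuous_fderiv one_ne_zero).clm_apply continuous_const
  have hc' : HasCompactSupport fun x => fderiv ℝ φ x h := hc.fderiv_apply ℝ h
  have hprim : ∀ τ : ℝ, ∫ s in 0..τ, ∫ x, u x * fderiv ℝ φ (x - s • h) h ∂μ
      = ∫ s in 0..τ, -∫ x, g x * φ (x - s • h) ∂μ := fun τ => by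
    calc ∫ s in 0..τ, ∫ x, u x * fderiv ℝ φ (x - s • h) h ∂μ
        = -∫ x, u x * (φ (x - τ • h) - φ x) ∂μ := by
          rw [← integral_mul_intervalIntegral_comp_sub_smul hu hφ' hc', ← integral_neg]
          simp_rw [intervalIntegral_fderiv_comp_sub_smul hφ, ← mul_neg, neg_sub]
      _ = -∫ x, (u (x + τ • h) - u x) * φ x ∂μ := by
          rw [integral_comp_add_sub_mul (hμ τ) (hu.locallyIntegrableOn univ)
            (subset_univ _) (by simp) hφ.continuous hc (subset_univ _), Measure.restrict_univ]
      _ = -∫ x, (∫ s in 0..τ, g (x + s • h)) * φ x ∂μ := by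
          rw [integral_congr_ae ((hincr τ).mono fun x hx => congrArg (· * φ x) hx)]
      _ = ∫ s in 0..τ, -∫ x, g x * φ (x - s • h) ∂μ := by
          rw [integral_intervalIntegral_comp_add_smul_mul hμ hg hφ.continuous hc,
            intervalIntegral.integral_neg]
  have hleft := (continuous_integral_mul_comp_sub_smul hu hφ' hc' h).integral_hasStrictDerivAt 0 0
  have hright := (continuous_integral_mul_comp_sub_smul hg.locallyIntegrable hφ.continuous hc
    h).neg.integral_hasStrictDerivAt 0 0
  rw [funext hprim] at hleft
  simpa using hleft.hasDerivAt.unique hright.hasDerivAt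

theorem lintegral_enorm_comp_add_sub_le (hμ : ∀ s : ℝ, MeasurePreserving (· + s • h) μ μ)
    (hg : Integrable g μ) (hincr : ∀ᵐ x ∂μ, u (x + h) - u x = ∫ s in 0..1, g (x + s • h)) :
    ∫⁻ x, ‖u (x + h) - u x‖ₑ ∂μ ≤ ∫⁻ x, ‖g x‖ₑ ∂μ := by
  have hmeas : AEMeasurable (fun p : E × ℝ => ‖g (p.1 + p.2 • h)‖ₑ)
      (μ.prod (volume.restrict (Ioc 0 1))) :=
    (integrable_uncurry_comp_add_smul hμ hg (volume.restrict (Ioc 0 1))).swap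
      |>.aestronglyMeasurable.enorm
  calc ∫⁻ x, ‖u (x + h) - u x‖ₑ ∂μ
      ≤ ∫⁻ x, (∫⁻ s in Ioc (0 : ℝ) 1, ‖g (x + s • h)‖ₑ) ∂μ := by
        refine lintegral_mono_ae (hincr.mono fun x hx => ?_)
        rw [hx, intervalIntegral.integral_of_le zero_le_one]
        exact enorm_integral_le_lintegral_enorm _
    _ = ∫⁻ s in Ioc (0 : ℝ) 1, (∫⁻ x, ‖g (x + s • h)‖ₑ ∂μ) := lintegral_lintegral_swap hmeas
    _ = ∫⁻ _ in Ioc (0 : ℝ) 1, (∫⁻ x, ‖g x‖ₑ ∂μ) :=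
        lintegral_congr fun s => (hμ s).lintegral_comp_emb
          (Homeomorph.addRight (s • h)).measurableEmbedding fun x => ‖g x‖ₑ
    _ = ∫⁻ x, ‖g x‖ₑ ∂μ := by simp

end InvariantMeasure

section VerticalTranslation

variable {α : Type*} [MeasurableSpace α]

/-- The measure `μ ⊗ dt` on the slab `α × J`. -/
abbrev slabMeasure (μ : Measure α) (J : Set ℝ) : Measure (α × ℝ) :=
  μ.prod (volume.restrict J)

theorem slabMeasure_mono (μ : Measure α) {J K : Set ℝ} (h : J ⊆ K) :
    slabMeasure μ J ≤ slabMeasure μ K :=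
  Measure.prod_mono le_rfl (Measure.restrict_mono_set volume h)

theorem slabMeasure_Ioo_le_of_Icc_subset (μ : Measure α) {a b c d : ℝ}
    (h : Icc c d ⊆ Icc a b) : slabMeasure μ (Ioo c d) ≤ slabMeasure μ (Ioo a b) :=
  slabMeasure_mono μ (by simpa only [interior_Icc] using interior_mono h)

variable {μ : Measure α} [SFinite μ] {J : Set ℝ}

theorem slabMeasure_eq_restrict (μ : Measure α) [SFinite μ] (J : Set ℝ) :
    slabMeasure μ J = (μ.prod volume).restrict (univ ×ˢ J) := by
  rw [← Measure.prod_restrict, Measure.restrict_univ]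

theorem ae_slabMeasure_iff (hJ : MeasurableSet J) {P : α × ℝ → Prop} :
    (∀ᵐ p ∂slabMeasure μ J, P p) ↔ ∀ᵐ p ∂μ.prod volume, p.2 ∈ J → P p := by
  rw [slabMeasure_eq_restrict, ae_restrict_iff' (MeasurableSet.univ.prod hJ)]
  simp only [mem_prod, mem_univ, true_and]

theorem ae_ae_ae_of_forall_ae_add {P : α → ℝ → ℝ → Prop}
    (hP : MeasurableSet {q : α × ℝ × ℝ | P q.1 q.2.1 q.2.2})
    (h : ∀ τ, ∀ᵐ p ∂μ.prod volume, P p.1 p.2 (p.2 + τ)) :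
    ∀ᵐ s : ℝ, ∀ᵐ t : ℝ, ∀ᵐ x ∂μ, P x s t := by
  have hslice : ∀ τ, ∀ᵐ s : ℝ, ∀ᵐ x ∂μ, P x s (s + τ) := fun τ => by
    have hPτ : MeasurableSet {p : α × ℝ | P p.1 p.2 (p.2 + τ)} :=
      hP.preimage (by fun_prop : Measurable fun p : α × ℝ => (p.1, p.2, p.2 + τ))
    exact (Measure.ae_ae_comm hPτ).1 (Measure.ae_ae_of_ae_prod (h τ))
  have hQ : MeasurableSet {q : ℝ × ℝ | ∀ᵐ x ∂μ, P x q.2 (q.2 + q.1)} := by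
    have hmeas : MeasurableSet {r : (ℝ × ℝ) × α | ¬P r.2 r.1.2 (r.1.2 + r.1.1)} :=
      (hP.preimage (by fun_prop :
        Measurable fun r : (ℝ × ℝ) × α => (r.2, r.1.2, r.1.2 + r.1.1))).compl
    exact measurable_measure_prodMk_left (ν := μ) hmeas (measurableSet_singleton 0)
  have hcomm : ∀ᵐ s : ℝ, ∀ᵐ τ : ℝ, ∀ᵐ x ∂μ, P x s (s + τ) :=
    (Measure.ae_ae_comm hQ).1 (Eventually.of_forall hslice)
  filter_upwards [hcomm] with s hs
  simpa only [add_sub_cancel] using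
    (measurePreserving_sub_right volume s).quasiMeasurePreserving.ae hs

theorem exists_stronglyMeasurable_ae_eq_comp_fst {F : α × ℝ → ℝ} (hJ : MeasurableSet J)
    (hJ₀ : volume J ≠ 0) (hF : AEStronglyMeasurable F (slabMeasure μ J))
    (hinv : ∀ τ, ∀ᵐ p ∂μ.prod volume, p.2 ∈ J → p.2 + τ ∈ J → F (p.1, p.2 + τ) = F p) :
    ∃ f : α → ℝ, StronglyMeasurable f ∧ F =ᵐ[slabMeasure μ J] fun p => f p.1 := by
  set F' := hF.mk F
  have hF' : StronglyMeasurable F' := hF.stronglyMeasurable_mk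
  have hFF' : ∀ᵐ p ∂μ.prod volume, p.2 ∈ J → F p = F' p := (ae_slabMeasure_iff hJ).1 hF.ae_eq_mk
  have hinv' : ∀ τ, ∀ᵐ p ∂μ.prod volume, p.2 ∈ J → p.2 + τ ∈ J →
      F' (p.1, p.2 + τ) = F' (p.1, p.2) := fun τ => by
    have hshift : MeasurePreserving (Prod.map id (· + τ)) (μ.prod volume) (μ.prod volume) :=
      (MeasurePreserving.id μ).prod (measurePreserving_add_right volume τ)
    filter_upwards [hinv τ, hFF', hshift.quasiMeasurePreserving.ae hFF'] with p hp h₀ hτ hpJ hpτ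
    rw [← h₀ hpJ, ← hp hpJ hpτ]
    exact (hτ hpτ).symm
  have hmeas : MeasurableSet {q : α × ℝ × ℝ |
      q.2.1 ∈ J → q.2.2 ∈ J → F' (q.1, q.2.2) = F' (q.1, q.2.1)} := by
    have hset : MeasurableSet {q : α × ℝ × ℝ | F' (q.1, q.2.2) = F' (q.1, q.2.1)} :=
      measurableSet_eq_fun (hF'.measurable.comp (by fun_prop)) (hF'.measurable.comp (by fun_prop))
    measurability
  obtain ⟨s, hsJ, hs⟩ := ((frequently_ae_mem_iff.2 hJ₀).and_eventually
    (ae_ae_ae_of_forall_ae_add (P := fun x s t => s ∈ J → t ∈ J → F' (x, t) = F' (x, s))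
      hmeas hinv')).exists
  refine ⟨fun x => F' (x, s), hF'.comp_measurable measurable_prodMk_right, ?_⟩
  have hset : MeasurableSet {q : ℝ × α | s ∈ J → q.1 ∈ J → F' (q.2, q.1) = F' (q.2, s)} :=
    hmeas.preimage (by fun_prop : Measurable fun q : ℝ × α => (q.2, s, q.1))
  have hprod := Measure.measurePreserving_swap.quasiMeasurePreserving.ae
    ((Measure.ae_prod_iff_ae_ae hset).2 hs)
  exact (ae_slabMeasure_iff hJ).2 <| by
    filter_upwards [hFF', hprod] with p hp hps hpJ using (hp hpJ).trans (hps hsJ hpJ)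

end VerticalTranslation

section SlabPrimitive

/-- The function on `α × ℝ` with value `f` at height `a` and vertical derivative `g`. It serves as
the precise representative of a function with weak vertical derivative `g`: it has a value at
every height, in particular on the two faces of a slab. -/
def slabPrimitive {α : Type*} (a : ℝ) (f : α → ℝ) (g : α × ℝ → ℝ) (p : α × ℝ) : ℝ :=
  f p.1 + ∫ s in a..p.2, g (p.1, s)

variable {α : Type*} [MeasurableSpace α] {μ : Measure α} {a b c d t : ℝ}
  {f : α → ℝ} {g u : α × ℝ → ℝ}

theorem integrable_intervalIntegral_slab (hg : Integrable g (slabMeasure μ (Ioo a b)))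
    (ht : t ∈ Icc a b) : Integrable (fun x => ∫ s in a..t, g (x, s)) μ := by
  simp_rw [intervalIntegral.integral_of_le ht.1, integral_Ioc_eq_integral_Ioo]
  exact (hg.mono_measure (slabMeasure_mono μ (Ioo_subset_Ioo_right ht.2))).integral_prod_left

variable [SFinite μ]

theorem ae_forall_intervalIntegrable_slab (hg : Integrable g (slabMeasure μ (Ioo a b))) :
    ∀ᵐ x ∂μ, ∀ s ∈ Icc a b, ∀ t ∈ Icc a b, IntervalIntegrable (fun r => g (x, r)) volume s t := by
  filter_upwards [hg.prod_right_ae] with x hx s hs t ht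
  rw [Measure.restrict_congr_set Ioo_ae_eq_Icc] at hx
  exact (IntegrableOn.mono_set hx (uIcc_subset_Icc hs ht)).intervalIntegrable

theorem ae_slabPrimitive_sub (hg : Integrable g (slabMeasure μ (Ioo a b))) (f : α → ℝ) :
    ∀ᵐ x ∂μ, ∀ s ∈ Icc a b, ∀ t ∈ Icc a b,
      slabPrimitive a f g (x, t) - slabPrimitive a f g (x, s) = ∫ r in s..t, g (x, r) := by
  filter_upwards [ae_forall_intervalIntegrable_slab hg] with x hx s hs t ht
  have ha : a ∈ Icc a b := left_mem_Icc.2 (hs.1.trans hs.2)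
  rw [slabPrimitive, slabPrimitive, add_sub_add_left_eq_sub]
  exact intervalIntegral.integral_interval_sub_left (hx a ha t ht) (hx a ha s hs)

theorem ae_enorm_slabPrimitive_sub_le (hg : Integrable g (slabMeasure μ (Ioo a b)))
    (hcd : Icc c d ⊆ Icc a b) (f : α → ℝ) :
    ∀ᵐ x ∂μ, ∀ s ∈ Icc c d, ∀ t ∈ Icc c d,
      ‖slabPrimitive a f g (x, t) - slabPrimitive a f g (x, s)‖ₑ
        ≤ ∫⁻ r in Ioo c d, ‖g (x, r)‖ₑ := by
  filter_upwards [ae_slabPrimitive_sub hg f] with x hx s hs t ht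
  rw [hx s (hcd hs) t (hcd ht), ← enorm_norm,
    intervalIntegral.norm_integral_eq_norm_integral_uIoc, enorm_norm,
    Measure.restrict_congr_set Ioo_ae_eq_Icc]
  exact (enorm_integral_le_lintegral_enorm _).trans
    (lintegral_mono_set (uIoc_subset_uIcc.trans (uIcc_subset_Icc hs ht)))

theorem lintegral_enorm_slabPrimitive_sub_le (hg : Integrable g (slabMeasure μ (Ioo a b)))
    (hab : a ≤ b) (f : α → ℝ) :
    ∫⁻ x, ‖slabPrimitive a f g (x, b) - slabPrimitive a f g (x, a)‖ₑ ∂μ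
      ≤ ∫⁻ p, ‖g p‖ₑ ∂slabMeasure μ (Ioo a b) := by
  rw [lintegral_prod _ hg.aestronglyMeasurable.enorm]
  exact lintegral_mono_ae <| (ae_enorm_slabPrimitive_sub_le hg Subset.rfl f).mono fun x hx =>
    hx a (left_mem_Icc.2 hab) b (right_mem_Icc.2 hab)

theorem aestronglyMeasurable_slab_intervalIntegral
    (hg : AEStronglyMeasurable g (slabMeasure μ (Ioo a b))) :
    AEStronglyMeasurable (fun p : α × ℝ => ∫ s in a..p.2, g (p.1, s))
      (slabMeasure μ (Ioo a b)) := by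
  have hg' : AEStronglyMeasurable (fun q : (α × ℝ) × ℝ => g (q.1.1, q.2))
      ((slabMeasure μ (Ioo a b)).prod (volume.restrict (Ioo a b))) :=
    hg.comp_quasiMeasurePreserving
      (QuasiMeasurePreserving.prodMap Measure.quasiMeasurePreserving_fst
        (.id (volume.restrict (Ioo a b))))
  have hset : MeasurableSet {q : (α × ℝ) × ℝ | q.2 ≤ q.1.2} :=
    measurableSet_le (by fun_prop) (by fun_prop)
  refine (hg'.indicator hset).integral_prod_right'.congr ?_
  refine (ae_slabMeasure_iff measurableSet_Ioo).2 (Eventually.of_forall fun p hp => ?_)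
  beta_reduce
  rw [intervalIntegral.integral_of_le hp.1.le,
    ← Measure.restrict_restrict_of_subset (Ioc_subset_Ioo_right hp.2),
    ← integral_indicator measurableSet_Ioc]
  refine integral_congr_ae ((ae_restrict_mem measurableSet_Ioo).mono fun s hs => ?_)
  simp [indicator_apply, hs.1]

theorem aestronglyMeasurable_slabPrimitive (hf : AEStronglyMeasurable f μ)
    (hg : AEStronglyMeasurable g (slabMeasure μ (Ioo a b))) :
    AEStronglyMeasurable (slabPrimitive a f g) (slabMeasure μ (Ioo a b)) :=
  hf.comp_fst.add (aestronglyMeasurable_slab_intervalIntegral hg)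

theorem integrable_slab_intervalIntegral (hg : Integrable g (slabMeasure μ (Ioo a b))) :
    Integrable (fun p : α × ℝ => ∫ s in a..p.2, g (p.1, s)) (slabMeasure μ (Ioo a b)) := by
  refine (hg.integral_norm_prod_left.comp_fst (volume.restrict (Ioo a b))).mono'
    (aestronglyMeasurable_slab_intervalIntegral hg.aestronglyMeasurable) ?_
  have hfibre := Measure.quasiMeasurePreserving_fst (ν := volume.restrict (Ioo a b)).ae
    hg.prod_right_ae
  filter_upwards [hfibre, (ae_slabMeasure_iff measurableSet_Ioo).2
    (Eventually.of_forall fun p hp => hp)] with p hp hpJ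
  rw [intervalIntegral.integral_of_le hpJ.1.le]
  exact (norm_integral_le_integral_norm _).trans (setIntegral_mono_set hp.norm
    (.of_forall fun s => norm_nonneg _) (Ioc_subset_Ioo_right hpJ.2).eventuallyLE)

theorem exists_ae_eq_slabPrimitive (hab : a < b) (hg : Integrable g (slabMeasure μ (Ioo a b)))
    (hu : AEStronglyMeasurable u (slabMeasure μ (Ioo a b)))
    (hincr : ∀ τ, ∀ᵐ p ∂μ.prod volume, p.2 ∈ Ioo a b → p.2 + τ ∈ Ioo a b →
      u (p.1, p.2 + τ) - u p = ∫ s in p.2..p.2 + τ, g (p.1, s)) :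
    ∃ f : α → ℝ, StronglyMeasurable f ∧ u =ᵐ[slabMeasure μ (Ioo a b)] slabPrimitive a f g := by
  obtain ⟨f, hf, hfu⟩ := exists_stronglyMeasurable_ae_eq_comp_fst
    (F := fun p => u p - ∫ s in a..p.2, g (p.1, s)) measurableSet_Ioo
    (by simpa using hab) (hu.sub (aestronglyMeasurable_slab_intervalIntegral
      hg.aestronglyMeasurable)) fun τ => by
      filter_upwards [hincr τ, Measure.quasiMeasurePreserving_fst.ae
        (ae_slabPrimitive_sub hg fun _ => 0)] with p hp hsub hpJ hpτ
      have hdiff := hsub p.2 (Ioo_subset_Icc_self hpJ) (p.2 + τ) (Ioo_subset_Icc_self hpτ)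
      simp only [slabPrimitive, zero_add] at hdiff
      linarith [hp hpJ hpτ]
  exact ⟨f, hf, hfu.mono fun p hp => sub_eq_iff_eq_add.1 hp⟩

end SlabPrimitive

section SlabTopology

variable {X : Type*} [TopologicalSpace X] [MeasurableSpace X] {μ : Measure X} {a b t : ℝ}
  {f : X → ℝ} {g u v ψ : X × ℝ → ℝ}

theorem locallyIntegrable_slabPrimitive_left (hf : LocallyIntegrable f μ)
    (hg : Integrable g (slabMeasure μ (Ioo a b))) (ht : t ∈ Icc a b) :
    LocallyIntegrable (fun x => slabPrimitive a f g (x, t)) μ :=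
  hf.add (integrable_intervalIntegral_slab hg ht).locallyIntegrable

theorem integrable_slabPrimitive_left_mul [OpensMeasurableSpace X] [T2Space X]
    (hf : LocallyIntegrable f μ)
    (hg : Integrable g (slabMeasure μ (Ioo a b))) (ht : t ∈ Icc a b) (hψ : Continuous ψ)
    (hc : HasCompactSupport ψ) : Integrable (fun x => slabPrimitive a f g (x, t) * ψ (x, t)) μ :=
  (locallyIntegrable_slabPrimitive_left hf hg ht).integrable_smul_right_of_hasCompactSupport
    (by fun_prop) (hc.comp_isClosedEmbedding
      (LeftInverse.isClosedEmbedding (f := Prod.fst) (fun _ => rfl) (by fun_prop) (by fun_prop)))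

variable [SFinite μ]

theorem locallyIntegrable_slabPrimitive (hf : LocallyIntegrable f μ)
    (hg : Integrable g (slabMeasure μ (Ioo a b))) :
    LocallyIntegrable (slabPrimitive a f g) (slabMeasure μ (Ioo a b)) := by
  refine LocallyIntegrable.add (fun p => ?_)
    (integrable_slab_intervalIntegral hg).locallyIntegrable
  obtain ⟨U, hU, hfU⟩ := hf p.1
  refine ⟨U ×ˢ univ, prod_mem_nhds hU univ_mem, ?_⟩
  rw [IntegrableOn, ← Measure.prod_restrict, Measure.restrict_univ]
  exact hfU.comp_fst _

theorem locallyIntegrable_of_ae_eq_slabPrimitive [OpensMeasurableSpace X] [T2Space X]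
    [WeaklyLocallyCompactSpace X] (hab : a < b) (hg : Integrable g (slabMeasure μ (Ioo a b)))
    (hu : LocallyIntegrableOn u (univ ×ˢ Ioo a b) (μ.prod volume))
    (hrep : u =ᵐ[slabMeasure μ (Ioo a b)] slabPrimitive a f g) : LocallyIntegrable f μ := by
  refine locallyIntegrable_iff.2 fun K hK => ?_
  obtain ⟨c, hac, hcb⟩ := exists_between hab
  obtain ⟨d, hcd, hdb⟩ := exists_between hcb
  have hle : slabMeasure (μ.restrict K) (Icc c d) ≤ slabMeasure μ (Ioo a b) :=
    Measure.prod_mono Measure.restrict_le_self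
      (Measure.restrict_mono_set _ (Icc_subset_Ioo hac hdb))
  have huK : Integrable u (slabMeasure (μ.restrict K) (Icc c d)) := by
    rw [slabMeasure, Measure.prod_restrict]
    exact hu.integrableOn_compact_subset (prod_mono (subset_univ K) (Icc_subset_Ioo hac hdb))
      (hK.prod isCompact_Icc)
  have hf : Integrable (fun p : X × ℝ => f p.1) (slabMeasure (μ.restrict K) (Icc c d)) := by
    refine (huK.sub ((integrable_slab_intervalIntegral hg).mono_measure hle)).congr ?_
    filter_upwards [(Measure.absolutelyContinuous_of_le hle).ae_le hrep] with p hp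
    rw [Pi.sub_apply, hp, slabPrimitive, add_sub_cancel_right]
  exact hf.of_comp_fst (by simpa [Measure.restrict_eq_zero] using hcd)

theorem ae_forall_slabPrimitive_eq_of_continuousOn (hab : a < b)
    (hg : Integrable g (slabMeasure μ (Ioo a b)))
    (hv : ContinuousOn v (univ ×ˢ Icc a b))
    (hrep : slabPrimitive a f g =ᵐ[slabMeasure μ (Ioo a b)] v) :
    ∀ᵐ x ∂μ, ∀ t ∈ Icc a b, slabPrimitive a f g (x, t) = v (x, t) := by
  filter_upwards [Measure.ae_ae_of_ae_prod hrep, ae_forall_intervalIntegrable_slab hg]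
    with x hx hint
  rw [Measure.restrict_congr_set Ioo_ae_eq_Icc] at hx
  have hprim : ContinuousOn (fun t => slabPrimitive a f g (x, t)) (Icc a b) := by
    have hI := hint a (left_mem_Icc.2 hab.le) b (right_mem_Icc.2 hab.le)
    rw [← uIcc_of_le hab.le]
    exact (continuousOn_const (c := f x)).add
      (intervalIntegral.continuousOn_primitive_interval' hI left_mem_uIcc)
  exact Measure.eqOn_Icc_of_ae_eq volume hab.ne hx hprim
    (hv.comp (by fun_prop) fun t ht => ⟨mem_univ x, ht⟩)

end SlabTopology

section VerticalIntegrationByParts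

theorem integral_add_primitive_mul_deriv {g Ψ : ℝ → ℝ} {a b : ℝ}
    (hg : IntervalIntegrable g volume a b) (hΨ : ContDiff ℝ 1 Ψ) (c : ℝ) :
    ∫ t in a..b, (c + ∫ s in a..t, g s) * deriv Ψ t
      = (c + ∫ s in a..b, g s) * Ψ b - c * Ψ a - ∫ t in a..b, g t * Ψ t := by
  have hprim : AbsolutelyContinuousOnInterval (fun t => c + ∫ s in a..t, g s) a b :=
    contDiffOn_const.absolutelyContinuousOnInterval.add
      (hg.absolutelyContinuousOnInterval_intervalIntegral left_mem_uIcc)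
  have hderiv : ∫ t in a..b, deriv (fun t => c + ∫ s in a..t, g s) t * Ψ t
      = ∫ t in a..b, g t * Ψ t :=
    intervalIntegral.integral_congr_ae <| hg.ae_hasDerivAt_integral.mono fun t ht htab => by
      rw [((ht (uIoc_subset_uIcc htab) a left_mem_uIcc).const_add c).deriv]
  rw [hprim.integral_mul_deriv_eq_deriv_mul hΨ.contDiffOn.absolutelyContinuousOnInterval, hderiv,
    intervalIntegral.integral_same, add_zero]

variable {E : Type*} [NormedAddCommGroup E] [NormedSpace ℝ E] [MeasurableSpace E] [BorelSpace E]
  {μ : Measure E} [SFinite μ] {a b : ℝ} {f : E → ℝ}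
  {g ψ : E × ℝ → ℝ}

theorem integral_slabPrimitive_mul_fderiv (hab : a ≤ b) (hf : LocallyIntegrable f μ)
    (hg : Integrable g (slabMeasure μ (Ioo a b))) (hψ : ContDiff ℝ 1 ψ)
    (hc : HasCompactSupport ψ) :
    ∫ p, slabPrimitive a f g p * fderiv ℝ ψ p (0, 1) ∂slabMeasure μ (Ioo a b)
      = -(∫ p, g p * ψ p ∂slabMeasure μ (Ioo a b))
        + (∫ x, slabPrimitive a f g (x, b) * ψ (x, b) ∂μ
          - ∫ x, slabPrimitive a f g (x, a) * ψ (x, a) ∂μ) := by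
  obtain ⟨C, hC⟩ := hc.exists_bound_of_continuous hψ.continuous
  have hleft : Integrable (fun p => slabPrimitive a f g p * fderiv ℝ ψ p (0, 1))
      (slabMeasure μ (Ioo a b)) :=
    (locallyIntegrable_slabPrimitive hf hg).integrable_smul_right_of_hasCompactSupport
      ((hψ.continuous_fderiv one_ne_zero).clm_apply continuous_const) (hc.fderiv_apply ℝ _)
  have hright : Integrable (fun p => g p * ψ p) (slabMeasure μ (Ioo a b)) :=
    hg.mul_bdd (c := C) hψ.continuous.aestronglyMeasurable (.of_forall hC)
  have hfibre : ∀ᵐ x ∂μ, ∫ t in Ioo a b, slabPrimitive a f g (x, t) * fderiv ℝ ψ (x, t) (0, 1)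
      = slabPrimitive a f g (x, b) * ψ (x, b) - slabPrimitive a f g (x, a) * ψ (x, a)
        - ∫ t in Ioo a b, g (x, t) * ψ (x, t) := by
    filter_upwards [ae_forall_intervalIntegrable_slab hg] with x hx
    have hderiv : ∀ t : ℝ, fderiv ℝ ψ (x, t) (0, 1) = deriv (fun t => ψ (x, t)) t := fun t =>
      ((hψ.differentiable one_ne_zero (x, t)).hasFDerivAt.comp_hasDerivAt t
        ((hasDerivAt_const t x).prodMk (hasDerivAt_id t))).deriv.symm
    simp_rw [hderiv, ← integral_Ioc_eq_integral_Ioo, ← intervalIntegral.integral_of_le hab,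
      slabPrimitive, intervalIntegral.integral_same, add_zero]
    exact integral_add_primitive_mul_deriv
      (hx a (left_mem_Icc.2 hab) b (right_mem_Icc.2 hab)) (hψ.comp (by fun_prop)) (f x)
  have htop := integrable_slabPrimitive_left_mul hf hg (right_mem_Icc.2 hab) hψ.continuous hc
  have hbot := integrable_slabPrimitive_left_mul hf hg (left_mem_Icc.2 hab) hψ.continuous hc
  have hsub := htop.sub hbot
  rw [integral_prod _ hleft, integral_prod _ hright, integral_congr_ae hfibre,
    integral_sub (by exact hsub) hright.integral_prod_left, integral_sub htop hbot]
  ring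

end VerticalIntegrationByParts

section HorizontalTranslation

variable {E : Type*} [NormedAddCommGroup E] [NormedSpace ℝ E] [MeasurableSpace E] [BorelSpace E]
  [FiniteDimensional ℝ E] {μ : Measure E} [μ.IsAddHaarMeasure] {a b c d t : ℝ} {f : E → ℝ}
  {g G u w φ : E × ℝ → ℝ} {y : E}

theorem measurePreserving_slab_add_smul (μ : Measure E) [μ.IsAddHaarMeasure] (J : Set ℝ) (y : E)
    (s : ℝ) :
    MeasurePreserving (· + s • (y, (0 : ℝ))) (slabMeasure μ J) (slabMeasure μ J) := by
  convert! (measurePreserving_add_right μ (s • y)).prod (.id (volume.restrict J)) using 1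
  ext p <;> simp

namespace HasWeakLineDeriv

theorem ae_slab_sub_eq_intervalIntegral
    (hw : HasWeakLineDeriv (μ.prod volume) (univ ×ˢ Ioo a b) u G (y, 0))
    (hu : LocallyIntegrableOn u (univ ×ˢ Ioo a b) (μ.prod volume))
    (hG : Integrable G (slabMeasure μ (Ioo a b))) (hrep : u =ᵐ[slabMeasure μ (Ioo a b)] w)
    (τ : ℝ) :
    ∀ᵐ p ∂slabMeasure μ (Ioo a b),
      w (p + τ • (y, (0 : ℝ))) - w p = ∫ s in 0..τ, G (p + s • (y, (0 : ℝ))) := by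
  have hG' : IntegrableOn G (univ ×ˢ Ioo a b) (μ.prod volume) := by
    rwa [IntegrableOn, ← slabMeasure_eq_restrict]
  have hincr : ∀ᵐ p ∂slabMeasure μ (Ioo a b), u (p + τ • (y, (0 : ℝ))) - u p
      = ∫ s in 0..τ, G (p + s • (y, (0 : ℝ))) := by
    refine (ae_slabMeasure_iff measurableSet_Ioo).2 ?_
    filter_upwards [hw.ae_sub_eq_intervalIntegral (isOpen_univ.prod isOpen_Ioo) hu hG' τ]
      with p hp hpJ
    exact hp fun s _ => by simpa using hpJ
  filter_upwards [hincr, hrep, (measurePreserving_slab_add_smul μ (Ioo a b) y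
    τ).quasiMeasurePreserving.ae hrep] with p hp h₀ hτ
  rw [← hp, h₀, hτ]

theorem integral_slab_mul_fderiv
    (hw : HasWeakLineDeriv (μ.prod volume) (univ ×ˢ Ioo a b) u G (y, 0))
    (hu : LocallyIntegrableOn u (univ ×ˢ Ioo a b) (μ.prod volume))
    (hG : Integrable G (slabMeasure μ (Ioo a b))) (hrep : u =ᵐ[slabMeasure μ (Ioo a b)] w)
    (hloc : LocallyIntegrable w (slabMeasure μ (Ioo a b))) (hφ : ContDiff ℝ 1 φ)
    (hc : HasCompactSupport φ) :
    ∫ p, w p * fderiv ℝ φ p (y, 0) ∂slabMeasure μ (Ioo a b)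
      = -∫ p, G p * φ p ∂slabMeasure μ (Ioo a b) :=
  integral_mul_fderiv_eq_neg (measurePreserving_slab_add_smul μ _ y) hloc hG
    (hw.ae_slab_sub_eq_intervalIntegral hu hG hrep) hφ hc

theorem exists_ae_eq_slabPrimitive (hab : a < b)
    (hw : HasWeakLineDeriv (μ.prod volume) (univ ×ˢ Ioo a b) u g (0, 1))
    (hu : LocallyIntegrableOn u (univ ×ˢ Ioo a b) (μ.prod volume))
    (hg : Integrable g (slabMeasure μ (Ioo a b))) :
    ∃ f : E → ℝ, LocallyIntegrable f μ ∧
      u =ᵐ[slabMeasure μ (Ioo a b)] slabPrimitive a f g := by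
  have hg' : IntegrableOn g (univ ×ˢ Ioo a b) (μ.prod volume) := by
    rwa [IntegrableOn, ← slabMeasure_eq_restrict]
  have hmeas : AEStronglyMeasurable u (slabMeasure μ (Ioo a b)) := by
    rw [slabMeasure_eq_restrict]
    exact hu.aestronglyMeasurable
  obtain ⟨f, -, hrep⟩ := _root_.exists_ae_eq_slabPrimitive hab hg hmeas fun τ => by
    filter_upwards [hw.ae_sub_eq_intervalIntegral (isOpen_univ.prod isOpen_Ioo) hu hg' τ]
      with p hp hp₀ hpτ
    have hseg : ∀ s ∈ uIcc 0 τ, p.2 + s ∈ Ioo a b := fun s hs =>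
      OrdConnected.uIcc_subset ordConnected_Ioo hp₀ hpτ <| by
        simpa [add_comm τ] using (mem_image_of_mem (p.2 + ·) hs : p.2 + s ∈ (p.2 + ·) '' uIcc 0 τ)
    have hadd : ∀ s : ℝ, p + s • ((0 : E), (1 : ℝ)) = (p.1, p.2 + s) := fun s => by
      ext <;> simp
    simp_rw [hadd] at hp
    rw [hp fun s hs => ⟨mem_univ _, hseg s hs⟩,
      intervalIntegral.integral_comp_add_left (fun r => g (p.1, r)), add_zero]
  exact ⟨f, locallyIntegrable_of_ae_eq_slabPrimitive hab hg hu hrep, hrep⟩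

end HasWeakLineDeriv

theorem ae_enorm_slabPrimitive_add_sub_le (hg : Integrable g (slabMeasure μ (Ioo a b)))
    (hcd : Icc c d ⊆ Icc a b) (ht : t ∈ Icc c d) (f : E → ℝ) (y : E) :
    ∀ᵐ x ∂μ, ∀ s ∈ Ioo c d, ‖slabPrimitive a f g (x + y, t) - slabPrimitive a f g (x, t)‖ₑ
      ≤ (∫⁻ r in Ioo c d, ‖g (x + y, r)‖ₑ) + (∫⁻ r in Ioo c d, ‖g (x, r)‖ₑ)
        + ‖slabPrimitive a f g (x + y, s) - slabPrimitive a f g (x, s)‖ₑ := by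
  have hle := ae_enorm_slabPrimitive_sub_le hg hcd f
  filter_upwards [hle, (measurePreserving_add_right μ y).quasiMeasurePreserving.ae hle]
    with x hx hxy s hs
  have hs' := Ioo_subset_Icc_self hs
  set W := slabPrimitive a f g
  calc ‖W (x + y, t) - W (x, t)‖ₑ
      = ‖(W (x + y, t) - W (x + y, s)) + (W (x, s) - W (x, t))
          + (W (x + y, s) - W (x, s))‖ₑ := by congr 1; ring
    _ ≤ ‖W (x + y, t) - W (x + y, s)‖ₑ + ‖W (x, s) - W (x, t)‖ₑ
          + ‖W (x + y, s) - W (x, s)‖ₑ :=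
        (enorm_add_le _ _).trans (add_le_add_left (enorm_add_le _ _) _)
    _ ≤ _ := by gcongr; exacts [hxy s hs' t ht, hx t ht s hs']

theorem lintegral_enorm_slabPrimitive_add_sub_le (hf : AEStronglyMeasurable f μ)
    (hg : Integrable g (slabMeasure μ (Ioo a b))) (hcd : Icc c d ⊆ Icc a b) (ht : t ∈ Icc c d)
    (hG : Integrable G (slabMeasure μ (Ioo c d)))
    (hincr : ∀ᵐ p ∂slabMeasure μ (Ioo c d),
      slabPrimitive a f g (p + (y, (0 : ℝ))) - slabPrimitive a f g p
        = ∫ s in 0..1, G (p + s • (y, (0 : ℝ)))) :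
    ENNReal.ofReal (d - c) *
        ∫⁻ x, ‖slabPrimitive a f g (x + y, t) - slabPrimitive a f g (x, t)‖ₑ ∂μ
      ≤ 2 * ENNReal.ofReal (d - c) * ∫⁻ p, ‖g p‖ₑ ∂slabMeasure μ (Ioo c d)
        + ∫⁻ p, ‖G p‖ₑ ∂slabMeasure μ (Ioo c d) := by
  set W := slabPrimitive a f g
  set ρ := slabMeasure μ (Ioo c d)
  have hρ : ρ ≤ slabMeasure μ (Ioo a b) :=
    Measure.prod_mono le_rfl <| Measure.restrict_mono_set _ <| by
      simpa only [interior_Icc] using interior_mono hcd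
  set osc := fun x => ∫⁻ r in Ioo c d, ‖g (x, r)‖ₑ
  have hgρ : AEMeasurable (fun p => ‖g p‖ₑ) ρ := (hg.mono_measure hρ).aestronglyMeasurable.enorm
  have hosc : AEMeasurable osc μ := hgρ.lintegral_prod_right'
  have hoscy : AEMeasurable (fun x => osc (x + y) + osc x) μ :=
    (hosc.comp_quasiMeasurePreserving
      (measurePreserving_add_right μ y).quasiMeasurePreserving).add hosc
  have hsum : ∫⁻ x, (osc (x + y) + osc x) ∂μ = 2 * ∫⁻ p, ‖g p‖ₑ ∂ρ := by
    rw [lintegral_add_right' _ hosc, lintegral_add_right_eq_self osc y, two_mul,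
      lintegral_prod _ hgρ]
  have hW : AEMeasurable (fun p => ‖W (p + (y, (0 : ℝ))) - W p‖ₑ) ρ := by
    have hWρ := (aestronglyMeasurable_slabPrimitive hf hg.1).mono_measure hρ
    have hmp := measurePreserving_slab_add_smul μ (Ioo c d) y 1
    rw [one_smul] at hmp
    exact ((hWρ.comp_measurePreserving hmp).sub hWρ).enorm
  calc ENNReal.ofReal (d - c) * ∫⁻ x, ‖W (x + y, t) - W (x, t)‖ₑ ∂μ
      = ∫⁻ _ in Ioo c d, ∫⁻ x, ‖W (x + y, t) - W (x, t)‖ₑ ∂μ := by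
        rw [setLIntegral_const, Real.volume_Ioo, mul_comm]
    _ ≤ ∫⁻ s in Ioo c d, ∫⁻ x, (osc (x + y) + osc x + ‖W (x + y, s) - W (x, s)‖ₑ) ∂μ :=
        setLIntegral_mono' measurableSet_Ioo fun s hs => lintegral_mono_ae <|
          (ae_enorm_slabPrimitive_add_sub_le hg hcd ht f y).mono fun x hx => hx s hs
    _ = ∫⁻ s in Ioo c d, (2 * ∫⁻ p, ‖g p‖ₑ ∂ρ + ∫⁻ x, ‖W (x + y, s) - W (x, s)‖ₑ ∂μ) :=
        lintegral_congr fun s => by rw [lintegral_add_left' hoscy, hsum]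
    _ = 2 * ENNReal.ofReal (d - c) * ∫⁻ p, ‖g p‖ₑ ∂ρ
          + ∫⁻ p, ‖W (p + (y, (0 : ℝ))) - W p‖ₑ ∂ρ := by
        rw [lintegral_add_left measurable_const, setLIntegral_const, Real.volume_Ioo,
          lintegral_prod_symm _ hW, mul_right_comm]
        simp only [Prod.mk_add_mk, add_zero]
    _ ≤ _ := add_le_add le_rfl
        (lintegral_enorm_comp_add_sub_le (measurePreserving_slab_add_smul μ _ y) hG hincr)

end HorizontalTranslation

section WeakDerivative

variable {E F : Type*} [NormedAddCommGroup E] [NormedSpace ℝ E] [MeasurableSpace E]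
  [NormedAddCommGroup F] [NormedSpace ℝ F] [MeasurableSpace F]
  {μ : Measure E} {ν : Measure F} {Ω : Set E} {u v g k φ : E → ℝ} {h : E}

theorem HasWeakLineDeriv.congr_left (hw : HasWeakLineDeriv μ Ω u g h)
    (huv : u =ᵐ[μ.restrict Ω] v) :
    HasWeakLineDeriv μ Ω v g h := fun φ hφ hc hs => by
  rw [← hw φ hφ hc hs]
  exact integral_congr_ae (huv.mono fun x hx => by simp only [hx])

variable [BorelSpace E] [BorelSpace F]

theorem integrableOn_mul_fderiv_of_tsupport_subset (hu : LocallyIntegrableOn u Ω μ)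
    (hφ : ContDiff ℝ 1 φ) (hc : HasCompactSupport φ) (hs : tsupport φ ⊆ Ω) (h : E) :
    IntegrableOn (fun x => u x * fderiv ℝ φ x h) Ω μ :=
  (integrable_mul_of_tsupport_subset hu
    ((hφ.continuous_fderiv one_ne_zero).clm_apply continuous_const) (hc.fderiv_apply ℝ h)
    ((tsupport_fderiv_apply_subset ℝ h).trans hs)).integrableOn

namespace HasWeakLineDeriv

theorem smul_add (hw : HasWeakLineDeriv μ Ω u g h) (hw' : HasWeakLineDeriv μ Ω v k h)
    (hu : LocallyIntegrableOn u Ω μ) (hv : LocallyIntegrableOn v Ω μ)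
    (hg : LocallyIntegrableOn g Ω μ) (hk : LocallyIntegrableOn k Ω μ) (a : ℝ) :
    HasWeakLineDeriv μ Ω (fun x => a * u x + v x) (fun x => a * g x + k x) h :=
  fun φ hφ hc hs => by
    have hφ' : ContDiff ℝ 1 φ := hφ.of_le (mod_cast le_top)
    simp only [add_mul, mul_assoc]
    rw [integral_add
        ((integrableOn_mul_fderiv_of_tsupport_subset hu hφ' hc hs h).const_mul a)
        (integrableOn_mul_fderiv_of_tsupport_subset hv hφ' hc hs h),
      integral_add
        ((integrable_mul_of_tsupport_subset hg hφ.continuous hc hs).integrableOn.const_mul a)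
        (integrable_mul_of_tsupport_subset hk hφ.continuous hc hs).integrableOn,
      integral_const_mul, integral_const_mul, hw φ hφ hc hs, hw' φ hφ hc hs]
    ring

theorem sum_smul {ι : Type*} {s : Finset ι} {G : ι → E → ℝ} {e : ι → E}
    (hw : ∀ i ∈ s, HasWeakLineDeriv μ Ω u (G i) (e i)) (hu : LocallyIntegrableOn u Ω μ)
    (hG : ∀ i ∈ s, LocallyIntegrableOn (G i) Ω μ) (c : ι → ℝ) :
    HasWeakLineDeriv μ Ω u (fun x => ∑ i ∈ s, c i * G i x) (∑ i ∈ s, c i • e i) :=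
  fun φ hφ hc hs => by
    simp only [map_sum, map_smul, smul_eq_mul, Finset.mul_sum, Finset.sum_mul, mul_left_comm (u _),
      mul_assoc]
    rw [integral_finsetSum s fun i _ => (integrableOn_mul_fderiv_of_tsupport_subset hu
        (hφ.of_le (mod_cast le_top)) hc hs (e i)).const_mul (c i),
      integral_finsetSum s fun i hi =>
        ((integrable_mul_of_tsupport_subset (hG i hi) hφ.continuous hc hs).integrableOn.const_mul
          (c i)),
      ← Finset.sum_neg_distrib]
    refine Finset.sum_congr rfl fun i hi => ?_
    rw [integral_const_mul, integral_const_mul, hw i hi φ hφ hc hs, mul_neg]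

theorem comp_equiv (L : F ≃L[ℝ] E) (hL : MeasurePreserving L ν μ) {y : F}
    (hw : HasWeakLineDeriv μ Ω u g (L y)) :
    HasWeakLineDeriv ν (L ⁻¹' Ω) (u ∘ L) (g ∘ L) y := fun φ hφ hc hs => by
  have hemb : MeasurableEmbedding L := L.toHomeomorph.measurableEmbedding
  have hderiv : ∀ x, fderiv ℝ φ x y = fderiv ℝ (φ ∘ L.symm) (L x) (L y) := fun x => by
    rw [L.symm.comp_right_fderiv]
    simp
  have hsupp : tsupport (φ ∘ L.symm) ⊆ Ω := by
    refine (tsupport_comp_eq_preimage φ L.symm.toHomeomorph).trans_subset fun x hx => ?_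
    simpa using hs hx
  have key := hw (φ ∘ L.symm) (hφ.comp L.symm.contDiff)
    (hc.comp_homeomorph L.symm.toHomeomorph) hsupp
  rw [← hL.setIntegral_preimage_emb hemb, ← hL.setIntegral_preimage_emb hemb] at key
  simpa only [comp_apply, hderiv, L.symm_apply_apply] using key

theorem ae_eq [FiniteDimensional ℝ E] (hw : HasWeakLineDeriv μ Ω u g h)
    (hw' : HasWeakLineDeriv μ Ω u k h) (hΩ : IsOpen Ω) (hg : LocallyIntegrableOn g Ω μ)
    (hk : LocallyIntegrableOn k Ω μ) : g =ᵐ[μ.restrict Ω] k := by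
  refine (ae_restrict_iff' hΩ.measurableSet).2 ?_
  have hzero := hΩ.ae_eq_zero_of_integral_contDiff_smul_eq_zero (hg.sub hk) fun φ hφ hc hs => by
    simp only [smul_eq_mul, mul_comm (φ _), Pi.sub_apply, sub_mul]
    rw [integral_sub (integrable_mul_of_tsupport_subset hg hφ.continuous hc hs)
        (integrable_mul_of_tsupport_subset hk hφ.continuous hc hs),
      ← setIntegral_mul_of_tsupport_subset (u := g) hs,
      ← setIntegral_mul_of_tsupport_subset (u := k) hs,
      sub_eq_zero, ← neg_inj, ← hw φ hφ hc hs, ← hw' φ hφ hc hs]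
  filter_upwards [hzero] with x hx hxΩ using sub_eq_zero.1 (hx hxΩ)

end HasWeakLineDeriv

end WeakDerivative

section Sobolev

variable {d : ℕ} {Ω : Set (EuclideanSpace ℝ (Fin d))}

theorem locallyIntegrableOn_sobolevRep (u : HomSobolev Ω) : LocallyIntegrableOn (sobolevRep u) Ω :=
  u.2.1

theorem hasWeakLineDeriv_weakPartial (u : HomSobolev Ω) (i : Fin d) :
    HasWeakLineDeriv volume Ω (sobolevRep u) (weakPartial u i) (EuclideanSpace.single i 1) :=
  hasWeakPartial_weakPartial u i

theorem sobolevRep_smul_add (a : ℝ) (u v : HomSobolev Ω) :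
    sobolevRep (a • u + v) =ᵐ[volume.restrict Ω]
      fun x => a * sobolevRep u x + sobolevRep v x := by
  filter_upwards [AEEqFun.coeFn_add (a • u.1) v.1, AEEqFun.coeFn_smul a u.1] with x hadd hsmul
  rw [Pi.add_apply, hsmul] at hadd
  exact hadd

theorem weakPartial_smul_add (hΩ : IsOpen Ω) (a : ℝ) (u v : HomSobolev Ω) (i : Fin d) :
    weakPartial (a • u + v) i =ᵐ[volume.restrict Ω]
      fun x => a * weakPartial u i x + weakPartial v i x := by
  have hloc : ∀ w : HomSobolev Ω, LocallyIntegrableOn (weakPartial w i) Ω := fun w =>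
    (integrableOn_weakPartial w i).locallyIntegrableOn
  exact ((hasWeakLineDeriv_weakPartial (a • u + v) i).congr_left
    (sobolevRep_smul_add a u v)).ae_eq
      ((hasWeakLineDeriv_weakPartial u i).smul_add (hasWeakLineDeriv_weakPartial v i)
        (locallyIntegrableOn_sobolevRep u) (locallyIntegrableOn_sobolevRep v) (hloc u) (hloc v) a)
      hΩ (hloc _) (((hloc u).smul a).add (hloc v))

theorem integrableOn_weakGradient (u : HomSobolev Ω) : IntegrableOn (weakGradient u) Ω :=
  Integrable.of_eval_piLp fun i => integrableOn_weakPartial u i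

theorem hasWeakLineDeriv_inner_weakGradient (u : HomSobolev Ω) (h : EuclideanSpace ℝ (Fin d)) :
    HasWeakLineDeriv volume Ω (sobolevRep u) (fun x => inner ℝ (weakGradient u x) h) h := by
  have key := HasWeakLineDeriv.sum_smul (s := Finset.univ)
    (fun i _ => hasWeakLineDeriv_weakPartial u i) (locallyIntegrableOn_sobolevRep u)
    (fun i _ => (integrableOn_weakPartial u i).locallyIntegrableOn) fun i => h i
  have hsum : ∑ i, h i • EuclideanSpace.single i (1 : ℝ) = h := by
    ext j
    simp [Pi.single_apply]
  simpa only [hsum, weakGradient, PiLp.inner_apply, RCLike.inner_apply, conj_trivial] using key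

theorem enorm_weakPartial_le (u : HomSobolev Ω) (i : Fin d) (x : EuclideanSpace ℝ (Fin d)) :
    ‖weakPartial u i x‖ₑ ≤ ‖weakGradient u x‖ₑ :=
  enorm_le_iff_norm_le.2 (PiLp.norm_apply_le (weakGradient u x) i)

end Sobolev

section Strip

variable {n : ℕ} {bm bp : ℝ}

@[simp] theorem withLast_last (x' : EuclideanSpace ℝ (Fin n)) (t : ℝ) :
    withLast x' t (Fin.last n) = t := by
  simp [withLast]

@[simp] theorem withLast_castSucc (x' : EuclideanSpace ℝ (Fin n)) (t : ℝ) (i : Fin n) :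
    withLast x' t i.castSucc = x' i := by
  simp [withLast]

/-- `withLast` as a linear homeomorphism `ℝ^n × ℝ ≃ ℝ^{n+1}`, used to carry the results on slabs in
a product over to the strip. It is not an isometry, the product having the supremum norm. -/
def withLastL (n : ℕ) :
    (EuclideanSpace ℝ (Fin n) × ℝ) ≃L[ℝ] EuclideanSpace ℝ (Fin (n + 1)) :=
  LinearEquiv.toContinuousLinearEquiv
    { toFun := fun p => withLast p.1 p.2
      invFun := fun x => (WithLp.toLp 2 fun i : Fin n => x i.castSucc, x (Fin.last n))
      map_add' := fun p q => by
        ext i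
        refine Fin.lastCases ?_ (fun j => ?_) i <;> simp
      map_smul' := fun c p => by
        ext i
        refine Fin.lastCases ?_ (fun j => ?_) i <;> simp
      left_inv := fun p => by
        refine Prod.ext ?_ (by simp)
        ext i
        simp
      right_inv := fun x => by
        ext i
        refine Fin.lastCases ?_ (fun j => ?_) i <;> simp }

@[simp] theorem withLastL_apply (p : EuclideanSpace ℝ (Fin n) × ℝ) :
    withLastL n p = withLast p.1 p.2 := rfl

@[simp] theorem withLastL_symm_withLast (x' : EuclideanSpace ℝ (Fin n)) (t : ℝ) :
    (withLastL n).symm (withLast x' t) = (x', t) :=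
  (withLastL n).symm_apply_apply (x', t)

theorem withLastL_zero_one (n : ℕ) :
    withLastL n (0, 1) = EuclideanSpace.single (Fin.last n) 1 := by
  ext i
  refine Fin.lastCases ?_ (fun j => ?_) i
  · simp
  · simp [(Fin.castSucc_lt_last j).ne]

theorem withLastL_single_zero (j : Fin n) :
    withLastL n (EuclideanSpace.single j 1, 0) = EuclideanSpace.single j.castSucc 1 := by
  ext i
  refine Fin.lastCases ?_ (fun k => ?_) i
  · simp [(Fin.castSucc_lt_last j).ne']
  · simp

theorem norm_withLast_zero (x' : EuclideanSpace ℝ (Fin n)) : ‖withLast x' 0‖ = ‖x'‖ := by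
  simp [EuclideanSpace.norm_eq, Fin.sum_univ_castSucc]

theorem isometry_withLast (b : ℝ) :
    Isometry (fun x' : EuclideanSpace ℝ (Fin n) => withLast x' b) :=
  Isometry.of_dist_eq fun x y => by
    have hsub : withLast x b - withLast y b = withLast (x - y) 0 := by
      simpa using ((withLastL n).map_sub (x, b) (y, b)).symm
    rw [dist_eq_norm, dist_eq_norm, hsub, norm_withLast_zero]

theorem measurableEmbedding_withLast_left (b : ℝ) :
    MeasurableEmbedding (fun x' : EuclideanSpace ℝ (Fin n) => withLast x' b) :=
  (isometry_withLast b).isClosedEmbedding.measurableEmbedding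

theorem range_withLast (b : ℝ) :
    range (fun x' : EuclideanSpace ℝ (Fin n) => withLast x' b) = {x | x (Fin.last n) = b} := by
  ext x
  constructor
  · rintro ⟨y, rfl⟩
    exact withLast_last y b
  · rintro rfl
    exact ⟨_, (withLastL n).apply_symm_apply x⟩

theorem withLastL_preimage (J : Set ℝ) :
    withLastL n ⁻¹' {x | x (Fin.last n) ∈ J} = univ ×ˢ J := by
  ext p
  simp

theorem measurePreserving_withLastL (n : ℕ) : MeasurePreserving (withLastL n) := by
  have hinsert := (volume_preserving_piFinSuccAbove (fun _ : Fin (n + 1) => ℝ) (Fin.last n)).symm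
  have hswap : MeasurePreserving (Prod.swap : EuclideanSpace ℝ (Fin n) × ℝ → _) :=
    Measure.measurePreserving_swap
  have hofLp : MeasurePreserving (Prod.map id WithLp.ofLp : ℝ × EuclideanSpace ℝ (Fin n) → _)
      (volume.prod volume) (volume.prod volume) :=
    (MeasurePreserving.id volume).prod (PiLp.volume_preserving_ofLp (Fin n))
  have hcomp := (PiLp.volume_preserving_toLp (Fin (n + 1))).comp (hinsert.comp (hofLp.comp hswap))
  convert! hcomp using 1
  funext p
  exact congrArg (WithLp.toLp 2) (Fin.insertNth_last' p.2 p.1.ofLp).symm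

theorem measurableEmbedding_withLastL (n : ℕ) : MeasurableEmbedding (withLastL n) :=
  (withLastL n).toHomeomorph.measurableEmbedding

theorem measurePreserving_withLastL_restrict (n : ℕ) (J : Set ℝ) :
    MeasurePreserving (withLastL n) (slabMeasure volume J)
      (volume.restrict {x | x (Fin.last n) ∈ J}) := by
  have h := (measurePreserving_withLastL n).restrict_preimage_emb
    (measurableEmbedding_withLastL n) {x | x (Fin.last n) ∈ J}
  rwa [withLastL_preimage, Measure.volume_eq_prod, ← slabMeasure_eq_restrict] at h

theorem isOpen_strip (n : ℕ) (bm bp : ℝ) : IsOpen (strip n bm bp) :=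
  isOpen_Ioo.preimage (by fun_prop : Continuous fun x : EuclideanSpace ℝ (Fin (n + 1)) =>
    x (Fin.last n))

theorem closure_strip (hb : bm < bp) :
    closure (strip n bm bp) = {x | x (Fin.last n) ∈ Icc bm bp} := by
  have hopen : IsOpenMap fun x : EuclideanSpace ℝ (Fin (n + 1)) => x (Fin.last n) :=
    isOpenMap_snd.comp (withLastL n).symm.toHomeomorph.isOpenMap
  rw [← closure_Ioo hb.ne]
  exact (hopen.preimage_closure_eq_closure_preimage (by fun_prop) (Ioo bm bp)).symm

theorem frontier_strip (hb : bm < bp) :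
    frontier (strip n bm bp) = {x | x (Fin.last n) = bm} ∪ {x | x (Fin.last n) = bp} := by
  rw [frontier, closure_strip hb, (isOpen_strip n bm bp).interior_eq]
  change (fun x : EuclideanSpace ℝ (Fin (n + 1)) => x (Fin.last n)) ⁻¹' (Icc bm bp \ Ioo bm bp) = _
  rw [Icc_sdiff_Ioo_same hb.le]
  rfl

theorem surfaceMeasure_strip (hb : bm < bp) :
    surfaceMeasure (strip n bm bp)
      = (volume : Measure (EuclideanSpace ℝ (Fin n))).map (fun x' => withLast x' bm)
        + (volume : Measure (EuclideanSpace ℝ (Fin n))).map (fun x' => withLast x' bp) := by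
  have hface : ∀ b : ℝ,
      (volume : Measure (EuclideanSpace ℝ (Fin n))).map (fun x' => withLast x' b)
        = (Measure.euclideanHausdorffMeasure n).restrict
          {x : EuclideanSpace ℝ (Fin (n + 1)) | x (Fin.last n) = b} := fun b => by
    rw [← EuclideanSpace.euclideanHausdorffMeasure_eq_volume,
      (isometry_withLast b).map_euclideanHausdorffMeasure, range_withLast]
  have hdisj : Disjoint {x : EuclideanSpace ℝ (Fin (n + 1)) | x (Fin.last n) = bm}
      {x | x (Fin.last n) = bp} :=
    disjoint_left.2 fun x hm hp => hb.ne (hm.symm.trans hp)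
  rw [surfaceMeasure, frontier_strip hb,
    Measure.restrict_union hdisj (measurableSet_eq_fun (by fun_prop) (by fun_prop)), hface, hface]

theorem ae_surfaceMeasure_strip_iff (hb : bm < bp) {P : EuclideanSpace ℝ (Fin (n + 1)) → Prop} :
    (∀ᵐ x ∂surfaceMeasure (strip n bm bp), P x) ↔
      ∀ b ∈ ({bm, bp} : Set ℝ), ∀ᵐ x' : EuclideanSpace ℝ (Fin n), P (withLast x' b) := by
  rw [surfaceMeasure_strip hb, ae_add_measure_iff,
    (measurableEmbedding_withLast_left bm).ae_map_iff,
    (measurableEmbedding_withLast_left bp).ae_map_iff]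
  simp only [mem_insert_iff, mem_singleton_iff, forall_eq_or_imp, forall_eq]

theorem integral_surfaceMeasure_strip (hb : bm < bp) {f : EuclideanSpace ℝ (Fin (n + 1)) → ℝ}
    (hf : Integrable f (surfaceMeasure (strip n bm bp))) :
    ∫ x, f x ∂surfaceMeasure (strip n bm bp) =
      (∫ x' : EuclideanSpace ℝ (Fin n), f (withLast x' bm))
        + ∫ x' : EuclideanSpace ℝ (Fin n), f (withLast x' bp) := by
  rw [surfaceMeasure_strip hb] at hf ⊢
  rw [integral_add_measure (integrable_add_measure.1 hf).1 (integrable_add_measure.1 hf).2,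
    (measurableEmbedding_withLast_left bm).integral_map,
    (measurableEmbedding_withLast_left bp).integral_map]

theorem locallyIntegrable_surfaceMeasure_strip (hb : bm < bp)
    {f : EuclideanSpace ℝ (Fin (n + 1)) → ℝ}
    (hf : ∀ b ∈ ({bm, bp} : Set ℝ),
      LocallyIntegrable fun x' : EuclideanSpace ℝ (Fin n) => f (withLast x' b)) :
    LocallyIntegrable f (surfaceMeasure (strip n bm bp)) := by
  refine locallyIntegrable_iff.2 fun K hK => ?_
  have hface : ∀ b ∈ ({bm, bp} : Set ℝ), IntegrableOn f K
      ((volume : Measure (EuclideanSpace ℝ (Fin n))).map fun x' => withLast x' b) :=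
    fun b hbb => (measurableEmbedding_withLast_left b).integrableOn_map_iff.2
      ((hf b hbb).integrableOn_isCompact
        ((isometry_withLast b).isClosedEmbedding.isCompact_preimage hK))
  rw [surfaceMeasure_strip hb, IntegrableOn, Measure.restrict_add, integrable_add_measure]
  exact ⟨hface bm (by simp), hface bp (by simp)⟩

end Strip

section PreciseRepresentative

variable {n : ℕ} {bm bp : ℝ}

theorem setIntegral_strip (F : EuclideanSpace ℝ (Fin (n + 1)) → ℝ) :
    ∫ x in strip n bm bp, F x = ∫ p, F (withLastL n p) ∂slabMeasure volume (Ioo bm bp) :=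
  ((measurePreserving_withLastL_restrict n (Ioo bm bp)).integral_comp
    (measurableEmbedding_withLastL n) F).symm

theorem setLIntegral_last_mem (J : Set ℝ) (F : EuclideanSpace ℝ (Fin (n + 1)) → ℝ≥0∞) :
    ∫⁻ x in {x | x (Fin.last n) ∈ J}, F x = ∫⁻ p, F (withLastL n p) ∂slabMeasure volume J :=
  ((measurePreserving_withLastL_restrict n J).lintegral_comp_emb
    (measurableEmbedding_withLastL n) F).symm

theorem ae_strip_iff {P : EuclideanSpace ℝ (Fin (n + 1)) → Prop} :
    (∀ᵐ x ∂volume.restrict (strip n bm bp), P x) ↔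
      ∀ᵐ p ∂slabMeasure volume (Ioo bm bp), P (withLastL n p) := by
  have hmap := (measurePreserving_withLastL_restrict n (Ioo bm bp)).map_eq
  rw [← (measurableEmbedding_withLastL n).ae_map_iff, hmap]
  rfl

theorem fderiv_comp_withLastL (ψ : EuclideanSpace ℝ (Fin (n + 1)) → ℝ)
    (p v : EuclideanSpace ℝ (Fin n) × ℝ) :
    fderiv ℝ (ψ ∘ withLastL n) p v = fderiv ℝ ψ (withLastL n p) (withLastL n v) := by
  rw [(withLastL n).comp_right_fderiv]
  rfl

theorem HasWeakLineDeriv.comp_withLastL {u g : EuclideanSpace ℝ (Fin (n + 1)) → ℝ}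
    {y : EuclideanSpace ℝ (Fin n) × ℝ}
    (hw : HasWeakLineDeriv volume (strip n bm bp) u g (withLastL n y)) :
    HasWeakLineDeriv (volume.prod volume) (univ ×ˢ Ioo bm bp) (u ∘ withLastL n)
      (g ∘ withLastL n) y := by
  rw [← withLastL_preimage]
  exact hw.comp_equiv (withLastL n) (measurePreserving_withLastL n)

theorem locallyIntegrableOn_sobolevRep_comp_withLastL (u : HomSobolev (strip n bm bp)) :
    LocallyIntegrableOn (sobolevRep u ∘ withLastL n) (univ ×ˢ Ioo bm bp)
      (volume.prod volume) := by
  rw [← withLastL_preimage]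
  exact locallyIntegrableOn_comp_homeomorph (withLastL n).toHomeomorph
    (measurePreserving_withLastL n) (locallyIntegrableOn_sobolevRep u)

theorem integrable_weakPartial_comp_withLastL (u : HomSobolev (strip n bm bp))
    (i : Fin (n + 1)) :
    Integrable (weakPartial u i ∘ withLastL n) (slabMeasure volume (Ioo bm bp)) :=
  ((measurePreserving_withLastL_restrict n (Ioo bm bp)).integrable_comp_emb
    (measurableEmbedding_withLastL n)).2 (integrableOn_weakPartial u i)

theorem integrable_inner_weakGradient_comp_withLastL (u : HomSobolev (strip n bm bp))
    (h : EuclideanSpace ℝ (Fin (n + 1))) :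
    Integrable (fun p => inner ℝ (weakGradient u (withLastL n p)) h)
      (slabMeasure volume (Ioo bm bp)) :=
  (((measurePreserving_withLastL_restrict n (Ioo bm bp)).integrable_comp_emb
    (measurableEmbedding_withLastL n)).2 (integrableOn_weakGradient u)).inner_const h

theorem exists_sobolevRep_comp_withLastL_ae_eq (hb : bm < bp) (u : HomSobolev (strip n bm bp)) :
    ∃ f : EuclideanSpace ℝ (Fin n) → ℝ, LocallyIntegrable f ∧
      sobolevRep u ∘ withLastL n =ᵐ[slabMeasure volume (Ioo bm bp)]
        slabPrimitive bm f (weakPartial u (Fin.last n) ∘ withLastL n) :=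
  HasWeakLineDeriv.exists_ae_eq_slabPrimitive hb
    (HasWeakLineDeriv.comp_withLastL <| by
      rw [withLastL_zero_one]
      exact hasWeakLineDeriv_weakPartial u (Fin.last n))
    (locallyIntegrableOn_sobolevRep_comp_withLastL u)
    (integrable_weakPartial_comp_withLastL u (Fin.last n))

/-- The value of `u` on the bottom face `x_{n+1} = b⁻`, as the constant of integration of
`∂_{n+1} u` along vertical lines. -/
def bottomTrace (hb : bm < bp) (u : HomSobolev (strip n bm bp)) : EuclideanSpace ℝ (Fin n) → ℝ :=
  (exists_sobolevRep_comp_withLastL_ae_eq hb u).choose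

theorem locallyIntegrable_bottomTrace (hb : bm < bp) (u : HomSobolev (strip n bm bp)) :
    LocallyIntegrable (bottomTrace hb u) :=
  (exists_sobolevRep_comp_withLastL_ae_eq hb u).choose_spec.1

/-- The representative `(x', t) ↦ f(x') + ∫_{b⁻}^t ∂_{n+1} u(x', s) ds` of `u`, which is absolutely
continuous on almost every vertical segment, up to the two faces. -/
def preciseRep (hb : bm < bp) (u : HomSobolev (strip n bm bp)) :
    EuclideanSpace ℝ (Fin n) × ℝ → ℝ :=
  slabPrimitive bm (bottomTrace hb u) (weakPartial u (Fin.last n) ∘ withLastL n)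

theorem sobolevRep_comp_withLastL_ae_eq_preciseRep (hb : bm < bp)
    (u : HomSobolev (strip n bm bp)) :
    sobolevRep u ∘ withLastL n =ᵐ[slabMeasure volume (Ioo bm bp)] preciseRep hb u :=
  (exists_sobolevRep_comp_withLastL_ae_eq hb u).choose_spec.2

theorem locallyIntegrable_preciseRep (hb : bm < bp) (u : HomSobolev (strip n bm bp)) :
    LocallyIntegrable (preciseRep hb u) (slabMeasure volume (Ioo bm bp)) :=
  locallyIntegrable_slabPrimitive (locallyIntegrable_bottomTrace hb u)
    (integrable_weakPartial_comp_withLastL u (Fin.last n))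

theorem locallyIntegrable_sobolevRep (hb : bm < bp) (u : HomSobolev (strip n bm bp)) :
    LocallyIntegrable (sobolevRep u) (volume.restrict (strip n bm bp)) := by
  have hsymm : MeasurePreserving (withLastL n).symm (volume.restrict (strip n bm bp))
      (slabMeasure volume (Ioo bm bp)) :=
    MeasurePreserving.symm (withLastL n).toHomeomorph.toMeasurableEquiv
      (measurePreserving_withLastL_restrict n (Ioo bm bp))
  have hloc := locallyIntegrableOn_univ.1 <| locallyIntegrableOn_comp_homeomorph
    (withLastL n).symm.toHomeomorph hsymm
    (locallyIntegrableOn_univ.2 (locallyIntegrable_preciseRep hb u))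
  refine hloc.congr (ae_strip_iff.2 ?_)
  filter_upwards [sobolevRep_comp_withLastL_ae_eq_preciseRep hb u] with p hp
  simpa using hp.symm

theorem integrableOn_sobolevRep_mul_partialDeriv (hb : bm < bp) (u : HomSobolev (strip n bm bp))
    {ψ : EuclideanSpace ℝ (Fin (n + 1)) → ℝ} (hψ : ContDiff ℝ 1 ψ) (hc : HasCompactSupport ψ)
    (i : Fin (n + 1)) :
    IntegrableOn (fun x => sobolevRep u x * partialDeriv i ψ x) (strip n bm bp) :=
  (locallyIntegrable_sobolevRep hb u).integrable_smul_right_of_hasCompactSupport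
    ((hψ.continuous_fderiv one_ne_zero).clm_apply continuous_const) (hc.fderiv_apply ℝ _)

theorem setIntegral_sobolevRep_mul_partialDeriv (hb : bm < bp) (u : HomSobolev (strip n bm bp))
    (ψ : EuclideanSpace ℝ (Fin (n + 1)) → ℝ) {i : Fin (n + 1)}
    {v : EuclideanSpace ℝ (Fin n) × ℝ} (hv : withLastL n v = EuclideanSpace.single i 1) :
    ∫ x in strip n bm bp, sobolevRep u x * partialDeriv i ψ x
      = ∫ p, preciseRep hb u p * fderiv ℝ (ψ ∘ withLastL n) p v
          ∂slabMeasure volume (Ioo bm bp) := by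
  rw [setIntegral_strip]
  refine integral_congr_ae ?_
  filter_upwards [sobolevRep_comp_withLastL_ae_eq_preciseRep hb u] with p hp
  rw [fderiv_comp_withLastL, hv, ← hp]
  rfl

theorem integral_preciseRep_by_parts_last (hb : bm < bp) (u : HomSobolev (strip n bm bp))
    {ψ : EuclideanSpace ℝ (Fin (n + 1)) → ℝ} (hψ : ContDiff ℝ 1 ψ) (hc : HasCompactSupport ψ) :
    ∫ x in strip n bm bp, sobolevRep u x * partialDeriv (Fin.last n) ψ x
      = -(∫ x in strip n bm bp, ψ x * weakPartial u (Fin.last n) x)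
        + ((∫ x', preciseRep hb u (x', bp) * ψ (withLast x' bp))
          - ∫ x', preciseRep hb u (x', bm) * ψ (withLast x' bm)) := by
  rw [setIntegral_sobolevRep_mul_partialDeriv hb u ψ (withLastL_zero_one n), setIntegral_strip]
  simp only [mul_comm (ψ (withLastL n _))]
  exact integral_slabPrimitive_mul_fderiv hb.le (locallyIntegrable_bottomTrace hb u)
    (integrable_weakPartial_comp_withLastL u (Fin.last n)) (hψ.comp (withLastL n).contDiff)
    (hc.comp_homeomorph (withLastL n).toHomeomorph)

theorem setIntegral_sobolevRep_mul_partialDeriv_castSucc (hb : bm < bp)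
    (u : HomSobolev (strip n bm bp)) {ψ : EuclideanSpace ℝ (Fin (n + 1)) → ℝ}
    (hψ : ContDiff ℝ 1 ψ) (hc : HasCompactSupport ψ) (j : Fin n) :
    ∫ x in strip n bm bp, sobolevRep u x * partialDeriv j.castSucc ψ x
      = -∫ x in strip n bm bp, ψ x * weakPartial u j.castSucc x := by
  have hw := hasWeakLineDeriv_weakPartial u j.castSucc
  rw [← withLastL_single_zero] at hw
  rw [setIntegral_sobolevRep_mul_partialDeriv hb u ψ (withLastL_single_zero j), setIntegral_strip]
  simp only [mul_comm (ψ (withLastL n _))]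
  exact hw.comp_withLastL.integral_slab_mul_fderiv
    (locallyIntegrableOn_sobolevRep_comp_withLastL u)
    (integrable_weakPartial_comp_withLastL u j.castSucc)
    (sobolevRep_comp_withLastL_ae_eq_preciseRep hb u) (locallyIntegrable_preciseRep hb u)
    (hψ.comp (withLastL n).contDiff) (hc.comp_homeomorph (withLastL n).toHomeomorph)

theorem ae_forall_preciseRep_eq_of_continuousOn (hb : bm < bp) {u : HomSobolev (strip n bm bp)}
    {v : EuclideanSpace ℝ (Fin (n + 1)) → ℝ} (hv : ContinuousOn v (closure (strip n bm bp)))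
    (huv : sobolevRep u =ᵐ[volume.restrict (strip n bm bp)] v) :
    ∀ᵐ x', ∀ t ∈ Icc bm bp, preciseRep hb u (x', t) = v (withLast x' t) := by
  rw [closure_strip hb] at hv
  have hv' : ContinuousOn (v ∘ withLastL n) (univ ×ˢ Icc bm bp) := by
    rw [← withLastL_preimage]
    exact hv.comp (withLastL n).continuous.continuousOn (mapsTo_preimage _ _)
  exact ae_forall_slabPrimitive_eq_of_continuousOn hb
    (integrable_weakPartial_comp_withLastL u (Fin.last n)) hv'
    ((sobolevRep_comp_withLastL_ae_eq_preciseRep hb u).symm.trans (ae_strip_iff.1 huv))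

theorem lintegral_enorm_preciseRep_sub_le (hb : bm < bp) (u : HomSobolev (strip n bm bp)) :
    ∫⁻ x', ‖preciseRep hb u (x', bp) - preciseRep hb u (x', bm)‖ₑ
      ≤ ∫⁻ x in strip n bm bp, ‖weakPartial u (Fin.last n) x‖ₑ :=
  (lintegral_enorm_slabPrimitive_sub_le
    (integrable_weakPartial_comp_withLastL u (Fin.last n)) hb.le _).trans_eq
      (setLIntegral_last_mem (Ioo bm bp) fun x => ‖weakPartial u (Fin.last n) x‖ₑ).symm

theorem ae_preciseRep_add_sub (hb : bm < bp) (u : HomSobolev (strip n bm bp))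
    (y : EuclideanSpace ℝ (Fin n)) :
    ∀ᵐ p ∂slabMeasure volume (Ioo bm bp),
      preciseRep hb u (p + (y, (0 : ℝ))) - preciseRep hb u p
        = ∫ s in 0..1, inner ℝ (weakGradient u (withLastL n (p + s • (y, (0 : ℝ)))))
            (withLast y 0) := by
  simpa using (hasWeakLineDeriv_inner_weakGradient u
    (withLastL n (y, 0))).comp_withLastL.ae_slab_sub_eq_intervalIntegral
      (locallyIntegrableOn_sobolevRep_comp_withLastL u)
      (integrable_inner_weakGradient_comp_withLastL u _)
      (sobolevRep_comp_withLastL_ae_eq_preciseRep hb u) 1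

theorem lintegral_enorm_preciseRep_add_sub_le (hb : bm < bp) (u : HomSobolev (strip n bm bp))
    {c d t : ℝ} {y : EuclideanSpace ℝ (Fin n)} (hcd : c < d) (hsub : Icc c d ⊆ Icc bm bp)
    (ht : t ∈ Icc c d) (hy : ‖y‖ ≤ d - c) :
    ∫⁻ x', ‖preciseRep hb u (x' + y, t) - preciseRep hb u (x', t)‖ₑ
      ≤ 3 * ∫⁻ x in {x | x (Fin.last n) ∈ Ioo c d}, ‖weakGradient u x‖ₑ := by
  have hmono := slabMeasure_Ioo_le_of_Icc_subset
    (volume : Measure (EuclideanSpace ℝ (Fin n))) hsub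
  have hinner : ∀ p, ‖(inner ℝ (weakGradient u (withLastL n p)) (withLast y 0) : ℝ)‖ₑ
      ≤ ENNReal.ofReal (d - c) * ‖weakGradient u (withLastL n p)‖ₑ := fun p => by
    rw [← ofReal_norm, ← ofReal_norm, ← ENNReal.ofReal_mul (by linarith)]
    refine ENNReal.ofReal_le_ofReal ((norm_inner_le_norm _ _).trans ?_)
    rw [mul_comm, norm_withLast_zero]
    gcongr
  have key := lintegral_enorm_slabPrimitive_add_sub_le
    (locallyIntegrable_bottomTrace hb u).aestronglyMeasurable
    (integrable_weakPartial_comp_withLastL u (Fin.last n)) hsub ht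
    ((integrable_inner_weakGradient_comp_withLastL u (withLast y 0)).mono_measure hmono)
    ((ae_preciseRep_add_sub hb u y).filter_mono (ae_mono hmono))
  rw [setLIntegral_last_mem]
  refine (ENNReal.mul_le_mul_iff_right (a := ENNReal.ofReal (d - c)) (by simpa using hcd)
    ENNReal.ofReal_ne_top).1 (key.trans ?_)
  calc _ ≤ 2 * ENNReal.ofReal (d - c) *
          (∫⁻ p, ‖weakGradient u (withLastL n p)‖ₑ ∂slabMeasure volume (Ioo c d))
        + ∫⁻ p, ENNReal.ofReal (d - c) * ‖weakGradient u (withLastL n p)‖ₑ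
            ∂slabMeasure volume (Ioo c d) := by
        gcongr with p p
        · exact enorm_weakPartial_le u _ _
        · exact hinner p
    _ = _ := by
        rw [lintegral_const_mul' _ _ ENNReal.ofReal_ne_top]
        ring

end PreciseRepresentative

section NormalFlux

variable {n : ℕ} {bm bp : ℝ} {ψ : EuclideanSpace ℝ (Fin (n + 1)) → ℝ}

theorem measurable_stripNormal (bp : ℝ) (i : Fin (n + 1)) : Measurable (stripNormal bp i) := by
  unfold stripNormal
  split_ifs
  · exact Measurable.ite (measurableSet_eq_fun (by fun_prop) (by fun_prop)) measurable_const
      measurable_const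
  · exact measurable_const

theorem norm_stripNormal_last (bp : ℝ) (x : EuclideanSpace ℝ (Fin (n + 1))) :
    ‖stripNormal bp (Fin.last n) x‖ = 1 := by
  rw [stripNormal, if_pos rfl]
  split_ifs <;> simp

/-- The flux `∫_{∂Ω} ψ T ν_{n+1} dℋ^n` of `T ∈ L¹_loc(∂Ω)` against `ψ`; the other components of the
normal vanish, so that this is the only boundary term in the divergence theorem. -/
def faceFlux (T : LocL1Boundary (strip n bm bp)) (ψ : EuclideanSpace ℝ (Fin (n + 1)) → ℝ) : ℝ :=
  ∫ x, ψ x * boundaryRep T x * stripNormal bp (Fin.last n) x ∂surfaceMeasure (strip n bm bp)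

/-- The integral `∫_Ω ∂_{n+1} (u ψ)`, expanded by the product rule. -/
def verticalFlux (u : HomSobolev (strip n bm bp)) (ψ : EuclideanSpace ℝ (Fin (n + 1)) → ℝ) : ℝ :=
  (∫ x in strip n bm bp, sobolevRep u x * partialDeriv (Fin.last n) ψ x)
    + ∫ x in strip n bm bp, ψ x * weakPartial u (Fin.last n) x

theorem locallyIntegrable_boundaryRep (T : LocL1Boundary (strip n bm bp)) :
    LocallyIntegrable (boundaryRep T) (surfaceMeasure (strip n bm bp)) :=
  T.2

theorem integrable_mul_boundaryRep_mul_stripNormal (T : LocL1Boundary (strip n bm bp))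
    (hψ : Continuous ψ) (hc : HasCompactSupport ψ) :
    Integrable (fun x => ψ x * boundaryRep T x * stripNormal bp (Fin.last n) x)
      (surfaceMeasure (strip n bm bp)) :=
  ((locallyIntegrable_boundaryRep T).integrable_smul_left_of_hasCompactSupport hψ hc).mul_bdd
    (c := 1) (measurable_stripNormal bp _).aestronglyMeasurable
    (.of_forall fun x => (norm_stripNormal_last bp x).le)

theorem faceFlux_eq_sub (hb : bm < bp) (T : LocL1Boundary (strip n bm bp)) (hψ : Continuous ψ)
    (hc : HasCompactSupport ψ) :
    faceFlux T ψ = (∫ x', boundaryRep T (withLast x' bp) * ψ (withLast x' bp))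
      - ∫ x', boundaryRep T (withLast x' bm) * ψ (withLast x' bm) := by
  rw [faceFlux, integral_surfaceMeasure_strip hb
    (integrable_mul_boundaryRep_mul_stripNormal T hψ hc), add_comm, sub_eq_add_neg]
  simp [stripNormal, hb.ne, integral_neg, mul_comm]

theorem boundaryRep_smul_add (a : ℝ) (T S : LocL1Boundary (strip n bm bp)) :
    boundaryRep (a • T + S) =ᵐ[surfaceMeasure (strip n bm bp)]
      fun x => a * boundaryRep T x + boundaryRep S x := by
  filter_upwards [AEEqFun.coeFn_add (a • T.1) S.1, AEEqFun.coeFn_smul a T.1] with x hadd hsmul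
  rw [Pi.add_apply, hsmul] at hadd
  exact hadd

theorem faceFlux_smul_add (a : ℝ) (T S : LocL1Boundary (strip n bm bp)) (hψ : Continuous ψ)
    (hc : HasCompactSupport ψ) : faceFlux (a • T + S) ψ = a * faceFlux T ψ + faceFlux S ψ := by
  unfold faceFlux
  rw [← integral_const_mul, ← integral_add
    ((integrable_mul_boundaryRep_mul_stripNormal T hψ hc).const_mul a)
    (integrable_mul_boundaryRep_mul_stripNormal S hψ hc)]
  refine integral_congr_ae ?_
  filter_upwards [boundaryRep_smul_add a T S] with x hx
  rw [hx]
  ring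

theorem verticalFlux_smul_add (hb : bm < bp) (a : ℝ) (u v : HomSobolev (strip n bm bp))
    (hψ : ContDiff ℝ 1 ψ) (hc : HasCompactSupport ψ) :
    verticalFlux (a • u + v) ψ = a * verticalFlux u ψ + verticalFlux v ψ := by
  obtain ⟨C, hC⟩ := hc.exists_bound_of_continuous hψ.continuous
  have hmulψ : ∀ w : HomSobolev (strip n bm bp),
      IntegrableOn (fun x => ψ x * weakPartial w (Fin.last n) x) (strip n bm bp) := fun w =>
    (integrableOn_weakPartial w _).bdd_mul hψ.continuous.aestronglyMeasurable (.of_forall hC)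
  have hu := integrableOn_sobolevRep_mul_partialDeriv hb u hψ hc (Fin.last n)
  have hv := integrableOn_sobolevRep_mul_partialDeriv hb v hψ hc (Fin.last n)
  have hrep : ∫ x in strip n bm bp, sobolevRep (a • u + v) x * partialDeriv (Fin.last n) ψ x
      = a * (∫ x in strip n bm bp, sobolevRep u x * partialDeriv (Fin.last n) ψ x)
        + ∫ x in strip n bm bp, sobolevRep v x * partialDeriv (Fin.last n) ψ x := by
    rw [← integral_const_mul, ← integral_add (hu.const_mul a) hv]
    refine integral_congr_ae ?_
    filter_upwards [sobolevRep_smul_add a u v] with x hx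
    rw [hx]
    ring
  have hpartial : ∫ x in strip n bm bp, ψ x * weakPartial (a • u + v) (Fin.last n) x
      = a * (∫ x in strip n bm bp, ψ x * weakPartial u (Fin.last n) x)
        + ∫ x in strip n bm bp, ψ x * weakPartial v (Fin.last n) x := by
    rw [← integral_const_mul, ← integral_add ((hmulψ u).const_mul a) (hmulψ v)]
    refine integral_congr_ae ?_
    filter_upwards [weakPartial_smul_add (isOpen_strip n bm bp) a u v (Fin.last n)] with x hx
    rw [hx]
    ring
  rw [verticalFlux, verticalFlux, verticalFlux, hrep, hpartial]
  ring

theorem LocL1Boundary.ext_of_faceFlux_eq {T S : LocL1Boundary (strip n bm bp)}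
    (h : ∀ ψ, ContDiff ℝ 1 ψ → HasCompactSupport ψ → faceFlux T ψ = faceFlux S ψ) : T = S := by
  have hloc : ∀ R : LocL1Boundary (strip n bm bp),
      LocallyIntegrable (fun x => boundaryRep R x * stripNormal bp (Fin.last n) x)
        (surfaceMeasure (strip n bm bp)) := fun R =>
    (locallyIntegrable_boundaryRep R).mono
      ((locallyIntegrable_boundaryRep R).aestronglyMeasurable.mul
        (measurable_stripNormal bp _).aestronglyMeasurable)
      (.of_forall fun x => by rw [norm_mul, norm_stripNormal_last, mul_one])
  have key := ae_eq_of_integral_contDiff_smul_eq (hloc T) (hloc S) fun ψ hψ hc => by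
    simpa only [smul_eq_mul, mul_assoc, faceFlux] using h ψ (hψ.of_le (mod_cast le_top)) hc
  refine Subtype.ext (AEEqFun.ext ?_)
  filter_upwards [key] with x hx
  exact mul_right_cancel₀
    (norm_ne_zero_iff.1 ((norm_stripNormal_last bp x).trans_ne one_ne_zero)) hx

end NormalFlux

section Trace

variable {n : ℕ} {bm bp : ℝ}

theorem locallyIntegrable_preciseRep_comp_symm (hb : bm < bp) (u : HomSobolev (strip n bm bp)) :
    LocallyIntegrable (preciseRep hb u ∘ (withLastL n).symm)
      (surfaceMeasure (strip n bm bp)) :=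
  locallyIntegrable_surfaceMeasure_strip hb fun b hbb => by
    have hbI : b ∈ Icc bm bp := by
      rcases hbb with rfl | rfl
      exacts [left_mem_Icc.2 hb.le, right_mem_Icc.2 hb.le]
    simp only [comp_apply, withLastL_symm_withLast]
    exact locallyIntegrable_slabPrimitive_left (locallyIntegrable_bottomTrace hb u)
      (integrable_weakPartial_comp_withLastL u (Fin.last n)) hbI

/-- The class in `L¹_loc(∂Ω)` of the boundary values of the precise representative of `u`. -/
def boundaryTrace (hb : bm < bp) (u : HomSobolev (strip n bm bp)) :
    LocL1Boundary (strip n bm bp) :=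
  ⟨AEEqFun.mk _ (locallyIntegrable_preciseRep_comp_symm hb u).aestronglyMeasurable,
    (locallyIntegrable_preciseRep_comp_symm hb u).congr (AEEqFun.coeFn_mk _ _).symm⟩

theorem ae_boundaryRep_boundaryTrace (hb : bm < bp) (u : HomSobolev (strip n bm bp)) :
    ∀ b ∈ ({bm, bp} : Set ℝ), ∀ᵐ x',
      boundaryRep (boundaryTrace hb u) (withLast x' b) = preciseRep hb u (x', b) := by
  have h : boundaryRep (boundaryTrace hb u) =ᵐ[surfaceMeasure (strip n bm bp)]
      preciseRep hb u ∘ (withLastL n).symm := AEEqFun.coeFn_mk _ _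
  simpa only [comp_apply, withLastL_symm_withLast] using (ae_surfaceMeasure_strip_iff hb).1 h

theorem boundaryRep_boundaryTrace_ae_eq_of_continuousOn (hb : bm < bp)
    {u : HomSobolev (strip n bm bp)} {v : EuclideanSpace ℝ (Fin (n + 1)) → ℝ}
    (hv : ContinuousOn v (closure (strip n bm bp)))
    (huv : sobolevRep u =ᵐ[volume.restrict (strip n bm bp)] v) :
    boundaryRep (boundaryTrace hb u) =ᵐ[surfaceMeasure (strip n bm bp)] v := by
  refine (ae_surfaceMeasure_strip_iff hb).2 fun b hbb => ?_
  have hbI : b ∈ Icc bm bp := by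
    rcases hbb with rfl | rfl
    exacts [left_mem_Icc.2 hb.le, right_mem_Icc.2 hb.le]
  filter_upwards [ae_forall_preciseRep_eq_of_continuousOn hb hv huv,
    ae_boundaryRep_boundaryTrace hb u b hbb] with x' hx hface
  rw [hface, hx b hbI]

theorem lintegral_enorm_boundaryTrace_sub_le (hb : bm < bp) (u : HomSobolev (strip n bm bp)) :
    ∫⁻ x', ‖boundaryRep (boundaryTrace hb u) (withLast x' bp)
        - boundaryRep (boundaryTrace hb u) (withLast x' bm)‖ₑ
      ≤ ∫⁻ x in strip n bm bp, ‖weakPartial u (Fin.last n) x‖ₑ := by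
  refine (lintegral_congr_ae ?_).trans_le (lintegral_enorm_preciseRep_sub_le hb u)
  filter_upwards [ae_boundaryRep_boundaryTrace hb u bm (by simp),
    ae_boundaryRep_boundaryTrace hb u bp (by simp)] with x' hm hp
  rw [hm, hp]

theorem faceModulus_boundaryTrace_le (hb : bm < bp) (u : HomSobolev (strip n bm bp)) {b ε : ℝ}
    (hε : 0 < ε) (hε' : ε < bp - bm) (hbb : b ∈ ({bm, bp} : Set ℝ)) :
    faceModulus (boundaryRep (boundaryTrace hb u)) b ε
      ≤ 3 * ∫⁻ x in stripCollar n bm bp ε, ‖weakGradient u x‖ₑ := by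
  obtain ⟨c, d, hcd, hsub, hbcd, hcollar⟩ : ∃ c d, d - c = ε ∧ Icc c d ⊆ Icc bm bp ∧
      b ∈ Icc c d ∧ Ioo c d ⊆ Ioo bm (bm + ε) ∪ Ioo (bp - ε) bp := by
    rcases hbb with rfl | rfl
    · exact ⟨b, b + ε, by ring, Icc_subset_Icc_right (by linarith), ⟨le_rfl, by linarith⟩,
        subset_union_left⟩
    · exact ⟨b - ε, b, by ring, Icc_subset_Icc_left (by linarith), ⟨by linarith, le_rfl⟩,
        subset_union_right⟩
  refine iSup₂_le fun y hy => ?_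
  have hface := ae_boundaryRep_boundaryTrace hb u b hbb
  calc _ = ∫⁻ x', ‖preciseRep hb u (x' + y, b) - preciseRep hb u (x', b)‖ₑ := by
        refine lintegral_congr_ae ?_
        filter_upwards [hface, (measurePreserving_add_right volume y).quasiMeasurePreserving.ae
          hface] with x' hx hxy
        rw [hx, hxy]
    _ ≤ 3 * ∫⁻ x in {x | x (Fin.last n) ∈ Ioo c d}, ‖weakGradient u x‖ₑ :=
        lintegral_enorm_preciseRep_add_sub_le hb u (by linarith) hsub hbcd (hcd ▸ hy)
    _ ≤ _ := by
        gcongr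
        exact fun x hx => hcollar hx

theorem measurableSet_stripCollar (n : ℕ) (bm bp ε : ℝ) :
    MeasurableSet (stripCollar n bm bp ε) :=
  measurableSet_preimage (f := fun x : EuclideanSpace ℝ (Fin (n + 1)) => x (Fin.last n))
    (by fun_prop) (measurableSet_Ioo.union measurableSet_Ioo)

theorem stripCollar_subset_strip {ε : ℝ} (hε : ε ≤ bp - bm) :
    stripCollar n bm bp ε ⊆ strip n bm bp := by
  rintro x (⟨h₁, h₂⟩ | ⟨h₁, h₂⟩)
  · exact ⟨h₁, by linarith⟩
  · exact ⟨by linarith, h₂⟩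

theorem eventually_notMem_stripCollar {x : EuclideanSpace ℝ (Fin (n + 1))}
    (hx : x ∈ strip n bm bp) : ∀ᶠ ε in 𝓝[>] 0, x ∉ stripCollar n bm bp ε := by
  filter_upwards [nhdsWithin_le_nhds (Iio_mem_nhds (sub_pos.2 hx.1)),
    nhdsWithin_le_nhds (Iio_mem_nhds (sub_pos.2 hx.2))] with ε hm hp
  rw [mem_Iio] at hm hp
  rintro (⟨-, h⟩ | ⟨h, -⟩) <;> linarith

theorem tendsto_setLIntegral_stripCollar (hb : bm < bp)
    {G : EuclideanSpace ℝ (Fin (n + 1)) → ℝ≥0∞}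
    (hGm : AEMeasurable G (volume.restrict (strip n bm bp)))
    (hG : ∫⁻ x in strip n bm bp, G x ≠ ⊤) :
    Tendsto (fun ε => ∫⁻ x in stripCollar n bm bp ε, G x) (𝓝[>] 0) (𝓝 0) := by
  have hstrip : MeasurableSet (strip n bm bp) := (isOpen_strip n bm bp).measurableSet
  have hlim : Tendsto
      (fun ε => ∫⁻ x in strip n bm bp, (stripCollar n bm bp ε).indicator G x) (𝓝[>] 0)
      (𝓝 (∫⁻ _ in strip n bm bp, 0)) :=
    tendsto_lintegral_filter_of_dominated_convergence' G
      (.of_forall fun ε => hGm.indicator (measurableSet_stripCollar n bm bp ε))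
      (.of_forall fun ε => .of_forall fun x => indicator_le_self _ G x) hG
      ((ae_restrict_mem hstrip).mono fun x hx => tendsto_nhds_of_eventually_eq <|
        (eventually_notMem_stripCollar hx).mono fun ε hε => indicator_of_notMem hε G)
  rw [lintegral_zero] at hlim
  refine hlim.congr' ?_
  filter_upwards [Ioo_mem_nhdsGT (sub_pos.2 hb)] with ε hε
  rw [lintegral_indicator (measurableSet_stripCollar n bm bp ε),
    Measure.restrict_restrict_of_subset (stripCollar_subset_strip hε.2.le)]

theorem tendsto_faceModulus_boundaryTrace (hb : bm < bp) (u : HomSobolev (strip n bm bp)) {b : ℝ}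
    (hbb : b ∈ ({bm, bp} : Set ℝ)) :
    Tendsto (fun ε => faceModulus (boundaryRep (boundaryTrace hb u)) b ε) (𝓝[>] 0) (𝓝 0) := by
  have hcollar : Tendsto (fun ε => 3 * ∫⁻ x in stripCollar n bm bp ε, ‖weakGradient u x‖ₑ)
      (𝓝[>] 0) (𝓝 0) := by
    simpa using ENNReal.Tendsto.const_mul (a := 3)
      (tendsto_setLIntegral_stripCollar hb
        (integrableOn_weakGradient u).aestronglyMeasurable.enorm
        (integrableOn_weakGradient u).2.ne) (.inr (by simp))
  refine tendsto_of_tendsto_of_tendsto_of_le_of_le' tendsto_const_nhds hcollar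
    (.of_forall fun _ => zero_le) ?_
  filter_upwards [Ioo_mem_nhdsGT (sub_pos.2 hb)] with ε hε
  exact faceModulus_boundaryTrace_le hb u hε.1 hε.2 hbb

theorem faceFlux_boundaryTrace (hb : bm < bp) (u : HomSobolev (strip n bm bp))
    {ψ : EuclideanSpace ℝ (Fin (n + 1)) → ℝ} (hψ : ContDiff ℝ 1 ψ) (hc : HasCompactSupport ψ) :
    faceFlux (boundaryTrace hb u) ψ = verticalFlux u ψ := by
  have hface : ∀ b ∈ ({bm, bp} : Set ℝ),
      ∫ x', boundaryRep (boundaryTrace hb u) (withLast x' b) * ψ (withLast x' b)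
        = ∫ x', preciseRep hb u (x', b) * ψ (withLast x' b) := fun b hbb =>
    integral_congr_ae ((ae_boundaryRep_boundaryTrace hb u b hbb).mono fun x' hx => by
      simp only [hx])
  rw [faceFlux_eq_sub hb _ hψ.continuous hc, hface bm (by simp), hface bp (by simp),
    verticalFlux, integral_preciseRep_by_parts_last hb u hψ hc]
  ring

theorem boundaryTrace_smul_add (hb : bm < bp) (a : ℝ) (u v : HomSobolev (strip n bm bp)) :
    boundaryTrace hb (a • u + v) = a • boundaryTrace hb u + boundaryTrace hb v :=
  LocL1Boundary.ext_of_faceFlux_eq fun ψ hψ hc => by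
    rw [faceFlux_smul_add a _ _ hψ.continuous hc, faceFlux_boundaryTrace hb _ hψ hc,
      faceFlux_boundaryTrace hb _ hψ hc, faceFlux_boundaryTrace hb _ hψ hc,
      verticalFlux_smul_add hb a u v hψ hc]

/-- The trace operator on the strip. -/
def stripTrace (hb : bm < bp) : HomSobolev (strip n bm bp) →ₗ[ℝ] LocL1Boundary (strip n bm bp) where
  toFun := boundaryTrace hb
  map_add' u v := by simpa using boundaryTrace_smul_add hb 1 u v
  map_smul' a u := by
    have h0 : boundaryTrace hb (0 : HomSobolev (strip n bm bp)) = 0 := by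
      simpa using boundaryTrace_smul_add hb 1 0 0
    simpa [h0] using boundaryTrace_smul_add hb a u 0

theorem setIntegral_sobolevRep_by_parts (hb : bm < bp) (u : HomSobolev (strip n bm bp))
    {ψ : EuclideanSpace ℝ (Fin (n + 1)) → ℝ} (hψ : ContDiff ℝ 1 ψ) (hc : HasCompactSupport ψ)
    (i : Fin (n + 1)) :
    ∫ x in strip n bm bp, sobolevRep u x * partialDeriv i ψ x
      = -(∫ x in strip n bm bp, ψ x * weakPartial u i x)
        + ∫ x, ψ x * boundaryRep (boundaryTrace hb u) x * stripNormal bp i x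
            ∂surfaceMeasure (strip n bm bp) := by
  induction i using Fin.lastCases with
  | last =>
    have hflux := faceFlux_boundaryTrace hb u hψ hc
    rw [faceFlux, verticalFlux] at hflux
    rw [hflux]
    ring
  | cast j =>
    simp only [stripNormal, (Fin.castSucc_lt_last j).ne, if_false, mul_zero, integral_zero,
      add_zero, setIntegral_sobolevRep_mul_partialDeriv_castSucc hb u hψ hc j]

theorem isStripTrace_stripTrace (hb : bm < bp) :
    IsStripTrace n bm bp 3 (stripTrace hb) where
  eq_of_continuous _ _ hv huv := boundaryRep_boundaryTrace_ae_eq_of_continuousOn hb hv huv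
  jump_le := lintegral_enorm_boundaryTrace_sub_le hb
  modulus_le u _ hε hε' _ hbb := by
    rw [ENNReal.ofReal_ofNat]
    exact faceModulus_boundaryTrace_le hb u hε hε' hbb
  modulus_tendsto u _ hbb := tendsto_faceModulus_boundaryTrace hb u hbb
  integrableOn_mul u _ hψ hc i := integrableOn_sobolevRep_mul_partialDeriv hb u hψ hc i
  integral_by_parts u _ hψ hc i := setIntegral_sobolevRep_by_parts hb u hψ hc i

theorem IsStripTrace.faceFlux_eq {c : ℝ}
    {Tr : HomSobolev (strip n bm bp) →ₗ[ℝ] LocL1Boundary (strip n bm bp)}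
    (h : IsStripTrace n bm bp c Tr) (u : HomSobolev (strip n bm bp))
    {ψ : EuclideanSpace ℝ (Fin (n + 1)) → ℝ} (hψ : ContDiff ℝ 1 ψ) (hc : HasCompactSupport ψ) :
    faceFlux (Tr u) ψ = verticalFlux u ψ := by
  rw [faceFlux, verticalFlux, h.integral_by_parts u ψ hψ hc (Fin.last n)]
  ring

theorem IsStripTrace.unique {c c' : ℝ}
    {Tr Tr' : HomSobolev (strip n bm bp) →ₗ[ℝ] LocL1Boundary (strip n bm bp)}
    (h : IsStripTrace n bm bp c Tr) (h' : IsStripTrace n bm bp c' Tr') : Tr = Tr' :=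
  LinearMap.ext fun u => LocL1Boundary.ext_of_faceFlux_eq fun ψ hψ hc => by
    rw [h.faceFlux_eq u hψ hc, h'.faceFlux_eq u hψ hc]

end Trace

end

theorem theorem1p4 (n : ℕ) (hn : 1 ≤ n) :
    ∃ c : ℝ, 0 < c ∧ ∀ bm bp : ℝ, bm < bp →
      ∃ Tr : HomSobolev (strip n bm bp) →ₗ[ℝ] LocL1Boundary (strip n bm bp),
        IsStripTrace n bm bp c Tr ∧
        ∀ (c' : ℝ) (Tr' : HomSobolev (strip n bm bp) →ₗ[ℝ] LocL1Boundary (strip n bm bp)),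
          IsStripTrace n bm bp c' Tr' → Tr' = Tr := by
  exact ⟨3, by norm_num, fun bm bp hb => ⟨stripTrace hb, isStripTrace_stripTrace hb,
    fun c' Tr' h' => h'.unique (isStripTrace_stripTrace hb)⟩⟩
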